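/- Let $n\ge 1$, let $M\subset\mathbb R^n$ be a bounded open set, and let $\mu$ be Lebesgue measure. **Spaces.** Let $V$ be a Hilbert space of square integrable $C^p$ vector fields on $M$ ($p\ge 1$) vanishing on $\partial M$, with $\sup_{i\le p}\sup_M|d^i w|\le c_V\|w\|_V$ for all $w\in V$; let $S$ be a Hilbert space of square integrable $C^q$ vector fields on $\mathbb R$ ($q\ge 1$) with $\sup_{i\le q}\sup_{\mathbb R}|d^i w|\le c_S\|w\|_S$ for all $w\in S$. Let $k_V,k_S$ be their reproducing kernels: $k_V(x,\cdot)\alpha\in V$ and $\langle k_V(x,\cdot)\alpha,w\rangle_V=\langle\alpha,w(x)\rangle$ for $w\in V$, $\alpha\in\mathbb R^n$; $k_S(x,\cdot)\in S$ and $\langle k_S(x,\cdot),w\rangle_S=w(x)$ for $w\in S$. **Images.** A nonempty open set $\Omega\subset\mathbb R^n$ is *Lipschitz* if for some $K$, near each of its boundary points and after an affine isometry, it is the region $\{(x',y)\in\mathbb R^{n-1}\times\mathbb R: y>w(x')\}$ above the graph of a $K$-Lipschitz function $w$. Let $I_0\in\mathrm{Im}(M)$, that is, $I_0:M\to\mathbb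 R$ has bounded variation and there is a finite partition $(U_i)$ of $M$ with $I_0|_{U_i}$ Lipschitz and $\Omega_i\subset U_i\subset\overline{\Omega_i}$ for a Lipschitz open set $\Omega_i$. Let $J_{I_0}\subset M$ be the jump set of $I_0$: the set of $x\in M$ for which there are reals $a\ne b$ and a unit vector $\nu$ such that the averages of $|I_0-a|$ over $B(x,r)\cap\{y:\langle y-x,\nu\rangle>0\}$ and of $|I_0-b|$ over $B(x,r)\cap\{y:\langle y-x,\nu\rangle<0\}$ tend to $0$ as $r\to0^+$. **Flows.** Let $v\in L^2([0,1],V)$ and $s\in L^2([0,1],S)$ have flows $\phi$ and $\eta$: for $r,t\in[0,1]$, $\phi_{r,t}(x)=x+\int_r^t v_u(\phi_{r,u}(x))\,du$ for $x\in M$ and $\eta_{r,t}(z)=z+\int_r^t s_u(\eta_{r,u}(z))\,du$ for $z\in\mathbb R$, with trajectories continuous in $t$. Put $I^s_t=\eta_{0,t}\circ I_0\circ\phi_{1,0}$. **Equations.** Let $\lambda,\beta>0$, $p_a\in L^1(M,\mathbb R^n)$, $p_b\in L^1(J_{I_0},\mathcal H^{n-1};\mathbb R^n)$, $p_c\in L^1(M,\mathbb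 R)$. Consider $$\beta s_t=\int_M p_c(y)\,d[\eta_{t,1}]_{I^s_t(y)}\,k_S(I^s_t(y),\cdot)\,d\mu(y),\tag{C}$$ $$\lambda v_t=\int_M k_V(\phi_{0,t}(x),\cdot)\,[d\phi_{0,t}]_x^{-1*}(p_a(x))\,d\mu(x)+\int_{J_{I_0}}k_V(\phi_{0,t}(x),\cdot)\,[d\phi_{0,t}]_x^{-1*}(p_b(x))\,d\mathcal H^{n-1}(x).\tag{D}$$ **Proposition.** 1. If $k_S$ is differentiable on $\mathbb R\times\mathbb R$ and (C) holds for almost every $t\in[0,1]$, then $\|s_t\|_S^2$ is constant: it has one and the same value at all $t\in[0,1]$ at which (C) holds (thus for all $t\in[0,1]$ if (C) holds for all $t$, and for almost every $t$ in general). 2. If $k_V$ is differentiable on $M\times M$ and (D) holds for almost every $t\in[0,1]$, then $\|v_t\|_V^2$ is constant: it has one and the same value at all $t\in[0,1]$ at which (D) holds. -/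

import Mathlib

open MeasureTheory Set Filter Topology
open scoped InnerProductSpace

namespace ImageMatching

noncomputable section

/-! ### Discontinuous images -/

/-- The divergence of a vector field on `ℝⁿ`. -/
def divergence {n : ℕ} (X : EuclideanSpace ℝ (Fin n) → EuclideanSpace ℝ (Fin n))
    (x : EuclideanSpace ℝ (Fin n)) : ℝ :=
  ∑ i, (fderiv ℝ X x (EuclideanSpace.single i 1)) i

/-- Functions of bounded variation on the open set `M`: `f ∈ L¹(M)` and
`∫_M f div X` is bounded above over `X ∈ C¹_c(M, ℝⁿ)` with `|X|_∞ ≤ 1`. -/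
def IsBV {n : ℕ} (M : Set (EuclideanSpace ℝ (Fin n))) (f : EuclideanSpace ℝ (Fin n) → ℝ) : Prop :=
  IntegrableOn f M ∧
    ∃ C : ℝ, ∀ X : EuclideanSpace ℝ (Fin n) → EuclideanSpace ℝ (Fin n),
      ContDiff ℝ 1 X → HasCompactSupport X → tsupport X ⊆ M → (∀ x, ‖X x‖ ≤ 1) →
        ∫ x in M, f x * divergence X x ≤ C

/-- Lipschitz open sets of `ℝⁿ` (`n ≥ 1`): near each boundary point, after an affine isometry
`ℝⁿ → ℝⁿ⁻¹ × ℝ`, the set is the part above the graph of a Lipschitz function on `ℝⁿ⁻¹`,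
with a Lipschitz constant that does not depend on the point. -/
def IsLipschitzOpen {n : ℕ} (Ω : Set (EuclideanSpace ℝ (Fin n))) : Prop :=
  Ω.Nonempty ∧ IsOpen Ω ∧
    ∃ K : NNReal, ∀ x ∈ frontier Ω,
      ∃ (I : EuclideanSpace ℝ (Fin n) ≃ᵃⁱ[ℝ] WithLp 2 (EuclideanSpace ℝ (Fin (n - 1)) × ℝ))
        (W : Set (EuclideanSpace ℝ (Fin n))) (w : EuclideanSpace ℝ (Fin (n - 1)) → ℝ),
        IsOpen W ∧ x ∈ W ∧ LipschitzWith K w ∧ ∀ y ∈ W, (y ∈ Ω ↔ w (I y).fst < (I y).snd)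

/-- Lipschitz domains in the wide sense: sets between a Lipschitz open set and its closure. -/
def IsLipschitzDomain {n : ℕ} (U : Set (EuclideanSpace ℝ (Fin n))) : Prop :=
  ∃ Ω, IsLipschitzOpen Ω ∧ Ω ⊆ U ∧ U ⊆ closure Ω

/-- The class `Im(M)`: functions of bounded variation on `M` that are Lipschitz on each piece of
some finite partition of `M` into Lipschitz domains. -/
def IsImage {n : ℕ} (M : Set (EuclideanSpace ℝ (Fin n)))
    (f : EuclideanSpace ℝ (Fin n) → ℝ) : Prop :=
  IsBV M f ∧
    ∃ (k : ℕ) (U : Fin (k + 1) → Set (EuclideanSpace ℝ (Fin n))),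
      (∀ i, IsLipschitzDomain (U i)) ∧ Pairwise (fun i j => Disjoint (U i) (U j)) ∧
        (⋃ i, U i) = M ∧ ∀ i, ∃ K : NNReal, LipschitzOnWith K f (U i)

/-- The jump set `J_f` in `M`: the points at which `f` has two different one-sided approximate
limits `a`, `b` on the two sides of a hyperplane. -/
def jumpSet {n : ℕ} (M : Set (EuclideanSpace ℝ (Fin n)))
    (f : EuclideanSpace ℝ (Fin n) → ℝ) : Set (EuclideanSpace ℝ (Fin n)) :=
  {x | x ∈ M ∧ ∃ (a b : ℝ) (ν : EuclideanSpace ℝ (Fin n)), a ≠ b ∧ ‖ν‖ = 1 ∧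
    Tendsto (fun r : ℝ => ⨍ y in Metric.ball x r ∩ {y | 0 < ⟪y - x, ν⟫_ℝ}, |f y - a|)
      (𝓝[>] 0) (𝓝 0) ∧
    Tendsto (fun r : ℝ => ⨍ y in Metric.ball x r ∩ {y | ⟪y - x, ν⟫_ℝ < 0}, |f y - b|)
      (𝓝[>] 0) (𝓝 0)}

/-! ### Spaces of vector fields and flows

A Hilbert space `H` of vector fields on an open set `U` of a Euclidean space `F` is given as a
Hilbert space of functions `F → F` (the class `RKHS`) whose elements are extended by `0` off `U`.
Then `RKHS.kerFun H x α : H` is `k_H(x, ·) α`, the element of `H` with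
`⟪k_H(x, ·) α, w⟫ = ⟪α, w x⟫` for every `w : H`. -/

/-- `H` is a Hilbert space of square integrable `C^p` vector fields on `U` which vanish on the
boundary of `U`, continuously embedded for the norm `‖·‖_{p,∞}`. -/
structure IsFieldSpace {F : Type*} [NormedAddCommGroup F] [InnerProductSpace ℝ F]
    [FiniteDimensional ℝ F] [MeasurableSpace F] [BorelSpace F]
    (p : ℕ) (U : Set F) (H : Type*) [NormedAddCommGroup H] [InnerProductSpace ℝ H]
    [CompleteSpace H] [RKHS ℝ H F F] : Prop where
  eq_zero : ∀ w : H, ∀ x ∉ U, w x = 0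
  continuous : ∀ w : H, Continuous (fun x => w x)
  contDiffOn : ∀ w : H, ContDiffOn ℝ p (fun x => w x) U
  memLp : ∀ w : H, MemLp (fun x => w x) 2 (volume : Measure F)
  bound : ∃ c : ℝ, ∀ w : H, ∀ i ≤ p, ∀ x ∈ U,
    ‖iteratedFDerivWithin ℝ i (fun x => w x) U x‖ ≤ c * ‖w‖

/-- The reproducing kernel of `H` is differentiable on `U × U`. -/
def HasDifferentiableKernel {F : Type*} [NormedAddCommGroup F] [InnerProductSpace ℝ F]
    [CompleteSpace F] (U : Set F) (H : Type*) [NormedAddCommGroup H] [InnerProductSpace ℝ H]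
    [CompleteSpace H] [RKHS ℝ H F F] : Prop :=
  DifferentiableOn ℝ (fun z : F × F => RKHS.kernel H z.1 z.2) (U ×ˢ U)

/-- `φ s t = φ_{s,t}` is the flow on `U`, over the time interval `[0, 1]`, of the time dependent
vector field `w`: `φ_{s,t}(x) = x + ∫_s^t w_r(φ_{s,r}(x)) dr`, with continuous trajectories. -/
def IsFlow {F : Type*} [NormedAddCommGroup F] [InnerProductSpace ℝ F]
    (U : Set F) {H : Type*} [NormedAddCommGroup H] [InnerProductSpace ℝ H] [RKHS ℝ H F F]
    (w : ℝ → H) (φ : ℝ → ℝ → F → F) : Prop :=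
  ∀ s ∈ Icc (0 : ℝ) 1, ∀ x ∈ U, ContinuousOn (fun t => φ s t x) (Icc 0 1) ∧
    ∀ t ∈ Icc (0 : ℝ) 1, φ s t x = x + ∫ r in s..t, w r (φ s r x)

/-! ### The geodesic equations -/

/-- The contrast equation at time `t`, an equality in `S`, where `I_t = η_{0,t} ∘ I₀ ∘ φ_{1,0}`:
`β s_t = ∫_M p_c(y) d[η_{t,1}]_{I_t(y)} k_S(I_t(y), ·) dμ(y)`. -/
def ContrastEquation {n : ℕ} {S : Type*} [NormedAddCommGroup S] [InnerProductSpace ℝ S]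
    [CompleteSpace S] [RKHS ℝ S ℝ ℝ] (M : Set (EuclideanSpace ℝ (Fin n))) (β : ℝ)
    (I₀ : EuclideanSpace ℝ (Fin n) → ℝ) (pc : EuclideanSpace ℝ (Fin n) → ℝ)
    (φ : ℝ → ℝ → EuclideanSpace ℝ (Fin n) → EuclideanSpace ℝ (Fin n)) (η : ℝ → ℝ → ℝ → ℝ)
    (s : ℝ → S) (t : ℝ) : Prop :=
  β • s t = ∫ y in M, (pc y * deriv (η t 1) (η 0 t (I₀ (φ 1 0 y)))) •
    RKHS.kerFun S (η 0 t (I₀ (φ 1 0 y))) (1 : ℝ)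

/-- The deformation equation at time `t`, an equality in `V`:
`λ v_t = ∫_M k_V(φ_{0,t}(x), ·) [dφ_{0,t}]_x^{-1*}(p_a(x)) dμ(x)
  + ∫_{J_{I₀}} k_V(φ_{0,t}(x), ·) [dφ_{0,t}]_x^{-1*}(p_b(x)) dℋⁿ⁻¹(x)`. -/
def DeformationEquation {n : ℕ} {V : Type*} [NormedAddCommGroup V] [InnerProductSpace ℝ V]
    [CompleteSpace V] [RKHS ℝ V (EuclideanSpace ℝ (Fin n)) (EuclideanSpace ℝ (Fin n))]
    (M : Set (EuclideanSpace ℝ (Fin n))) (lam : ℝ) (I₀ : EuclideanSpace ℝ (Fin n) → ℝ)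
    (pa pb : EuclideanSpace ℝ (Fin n) → EuclideanSpace ℝ (Fin n))
    (φ : ℝ → ℝ → EuclideanSpace ℝ (Fin n) → EuclideanSpace ℝ (Fin n))
    (v : ℝ → V) (t : ℝ) : Prop :=
  lam • v t =
    (∫ x in M, RKHS.kerFun V (φ 0 t x)
      (ContinuousLinearMap.adjoint (fderiv ℝ (φ 0 t) x).inverse (pa x))) +
    ∫ x in jumpSet M I₀, RKHS.kerFun V (φ 0 t x)
      (ContinuousLinearMap.adjoint (fderiv ℝ (φ 0 t) x).inverse (pb x))
      ∂(Measure.euclideanHausdorffMeasure (n - 1))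

end

end ImageMatching

/-!
The idea is that the momentum is transported by the flow. For a field `h` put `g_t(x) =
(dφ_{0,t})_x⁻¹ h(φ_{0,t}(x))`, the pullback of `h`. Both equations say that `κ ⟪w_t, h⟫ = ∫ ⟪π,
g_t⟫`, where `w` is the velocity, `κ` is a positive constant and `π` is a momentum that does not
depend on `t`. For the contrast equation this holds with `π(y) = p_c(y) dη_{0,1}(z)` placed at
`z = I₀(φ_{1,0}(y))`, because `d[η_{t,1}] = d[η_{0,1}] [dη_{0,t}]⁻¹`
(`smul_kerFun_eq_momentumField`).

Along the flow, `g_t` is absolutely continuous with derivative `(dφ_{0,t})⁻¹ [dh w_t - dw_t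
h](φ_{0,t})` (`IsCaratheodoryField.norm_pullback_sub_le`). The equations bound `w` uniformly in
time, hence this formula makes `w` Lipschitz in time. Now take `h = w_t + w_s`: then `κ (‖w_t‖² -
‖w_s‖²)` is the increment of `∫ ⟪π, g⟫` from `s` to `t`, and at an intermediate time `r` the
bracket of `h` with `w_r` is that of `h - 2 w_r` with `w_r`, of size `O(|t - s|)`. So the
increments of `‖w‖²` are `O(|t - s|²)` on a set of full measure, and `‖w‖²` is constant there
(`norm_sq_eq_of_momentum`, `eq_of_sub_le_sq`).

The velocity is merely square integrable in time, so the flow is of Carathéodory type. Its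
differentiability in the starting point (`IsPropagator.hasFDerivAt_flow`) follows from Grönwall's
inequality with an integrable kernel (`le_mul_exp_of_le_add_integral`) and from the Neumann series
for the variational equation (`exists_linear_integral_equation`). Fields that vanish off `M` are
globally Lipschitz, so their trajectories stay in `M`.
-/

namespace ImageMatching

/-! ### Absolutely continuous functions and linear integral equations -/

/-- Absolute continuity passes to a function whose increments are controlled by those of two
absolutely continuous functions. -/
theorem absolutelyContinuousOnInterval_of_dist_le {X Y Z : Type*} [PseudoMetricSpace X]
    [PseudoMetricSpace Y] [PseudoMetricSpace Z] {f : ℝ → X} {g₁ : ℝ → Y} {g₂ : ℝ → Z} {a b : ℝ}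
    (C : ℝ) (h₁ : AbsolutelyContinuousOnInterval g₁ a b)
    (h₂ : AbsolutelyContinuousOnInterval g₂ a b)
    (h : ∀ s ∈ uIcc a b, ∀ t ∈ uIcc a b,
      dist (f s) (f t) ≤ C * (dist (g₁ s) (g₁ t) + dist (g₂ s) (g₂ t))) :
    AbsolutelyContinuousOnInterval f a b := by
  have key := (Tendsto.add h₁ h₂).const_mul C
  rw [add_zero, mul_zero] at key
  refine squeeze_zero' (Eventually.of_forall fun E => Finset.sum_nonneg fun _ _ => dist_nonneg) ?_
    key
  have : ∀ᶠ E in AbsolutelyContinuousOnInterval.totalLengthFilter ⊓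
      𝓟 (AbsolutelyContinuousOnInterval.disjWithin a b),
      E ∈ AbsolutelyContinuousOnInterval.disjWithin a b :=
    eventually_inf_principal.mpr (by simp)
  filter_upwards [this] with E hE
  rw [← Finset.sum_add_distrib, Finset.mul_sum]
  exact Finset.sum_le_sum fun i hi => h _ (hE.1 i hi).1 _ (hE.1 i hi).2

/-- `F` is a primitive of the integrable function `f` on the interval between `a` and `b`. -/
structure IsPrimitive {E : Type*} [NormedAddCommGroup E] [NormedSpace ℝ E]
    (F f : ℝ → E) (a b : ℝ) : Prop where
  intervalIntegrable : IntervalIntegrable f volume a b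
  sub_eq : ∀ s ∈ uIcc a b, ∀ t ∈ uIcc a b, F t - F s = ∫ r in s..t, f r

namespace IsPrimitive

variable {E : Type*} [NormedAddCommGroup E] [NormedSpace ℝ E] {F f : ℝ → E} {a b : ℝ}

theorem of_eq_add {c : ℝ} (hc : c ∈ uIcc a b) (hf : IntervalIntegrable f volume a b) (e : E)
    (h : ∀ t ∈ uIcc a b, F t = e + ∫ r in c..t, f r) : IsPrimitive F f a b := by
  refine ⟨hf, fun s hs t ht => ?_⟩
  rw [h t ht, h s hs, add_sub_add_left_eq_sub, intervalIntegral.integral_interval_sub_left]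
  · exact hf.mono_set (uIcc_subset_uIcc hc ht)
  · exact hf.mono_set (uIcc_subset_uIcc hc hs)

theorem mono (h : IsPrimitive F f a b) {c d : ℝ} (hc : c ∈ uIcc a b) (hd : d ∈ uIcc a b) :
    IsPrimitive F f c d :=
  ⟨h.intervalIntegrable.mono_set (uIcc_subset_uIcc hc hd), fun s hs t ht =>
    h.sub_eq s (uIcc_subset_uIcc hc hd hs) t (uIcc_subset_uIcc hc hd ht)⟩

theorem absolutelyContinuous (h : IsPrimitive F f a b) :
    AbsolutelyContinuousOnInterval F a b := by
  have hn := h.intervalIntegrable.norm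
  have hac := hn.absolutelyContinuousOnInterval_intervalIntegral (c := a) left_mem_uIcc
  refine absolutelyContinuousOnInterval_of_dist_le 1 hac hac fun s hs t ht => ?_
  have h1 : dist (F s) (F t) ≤ |∫ r in s..t, ‖f r‖| := by
    rw [dist_comm, dist_eq_norm, h.sub_eq s hs t ht]
    exact intervalIntegral.norm_integral_le_abs_integral_norm
  have h2 : dist (∫ r in a..s, ‖f r‖) (∫ r in a..t, ‖f r‖) = |∫ r in s..t, ‖f r‖| := by
    rw [dist_comm, Real.dist_eq, intervalIntegral.integral_interval_sub_left]
    · exact hn.mono_set (uIcc_subset_uIcc left_mem_uIcc ht)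
    · exact hn.mono_set (uIcc_subset_uIcc left_mem_uIcc hs)
  rw [one_mul, h2]
  linarith [abs_nonneg (∫ r in s..t, ‖f r‖)]

theorem continuousOn (h : IsPrimitive F f a b) : ContinuousOn F (uIcc a b) :=
  h.absolutelyContinuous.continuousOn

theorem ae_hasDerivAt [CompleteSpace E] (h : IsPrimitive F f a b) :
    ∀ᵐ t, t ∈ uIcc a b → HasDerivAt F (f t) t := by
  have ha : ∀ᵐ t : ℝ, t ≠ a := by simp [ae_iff, measure_singleton]
  have hb : ∀ᵐ t : ℝ, t ≠ b := by simp [ae_iff, measure_singleton]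
  filter_upwards [h.intervalIntegrable.ae_hasDerivAt_integral, ha, hb] with t ht hta htb hmem
  have hnhds : uIcc a b ∈ 𝓝 t := by
    refine Icc_mem_nhds ?_ ?_
    · exact lt_of_le_of_ne hmem.1
        (by rcases min_choice a b with h | h <;> simp [h, hta.symm, htb.symm])
    · exact lt_of_le_of_ne hmem.2
        (by rcases max_choice a b with h | h <;> simp [h, hta, htb])
  refine ((ht hmem a left_mem_uIcc).const_add (F a)).congr_of_eventuallyEq ?_
  filter_upwards [hnhds] with r hr
  rw [← h.sub_eq a left_mem_uIcc r hr]; abel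

end IsPrimitive

/-- An absolutely continuous curve moves at most as fast as an almost everywhere bound of its
speed. -/
theorem norm_sub_le_of_ae_hasDerivAt {E : Type*} [NormedAddCommGroup E] [NormedSpace ℝ E]
    {F F' : ℝ → E} {a b D : ℝ} (hF : AbsolutelyContinuousOnInterval F a b)
    (hd : ∀ᵐ t, t ∈ uIcc a b → HasDerivAt F (F' t) t)
    (hD : ∀ᵐ t, t ∈ uIcc a b → ‖F' t‖ ≤ D) : ‖F b - F a‖ ≤ D * |b - a| := by
  obtain ⟨g, hg1, hg⟩ := exists_dual_vector'' ℝ (F b - F a)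
  have hac : AbsolutelyContinuousOnInterval (fun t => g (F t)) a b := by
    refine absolutelyContinuousOnInterval_of_dist_le 1 hF hF fun s _ t _ => ?_
    rw [dist_eq_norm, dist_eq_norm, ← map_sub]
    have := g.le_of_opNorm_le hg1 (F s - F t)
    linarith [norm_nonneg (F s - F t)]
  have h1 := hac.integral_deriv_eq_sub
  rw [← map_sub, hg] at h1
  have h2 : ‖∫ t in a..b, deriv (fun t => g (F t)) t‖ ≤ D * |b - a| := by
    refine intervalIntegral.norm_integral_le_of_norm_le_const_ae ?_
    filter_upwards [hd, hD] with t hdt hDt ht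
    have ht := uIoc_subset_uIcc ht
    have : deriv (fun t => g (F t)) t = g (F' t) := (g.hasFDerivAt.comp_hasDerivAt t (hdt ht)).deriv
    rw [this]
    have := g.le_of_opNorm_le hg1 (F' t)
    linarith [hDt ht]
  rw [h1] at h2
  exact (le_abs_self _).trans h2

/-- Change of variables `∫ Φ'(m) dm = Φ(m(b)) - Φ(m(a))` along the primitive `m` of an integrable
function. -/
theorem integral_deriv_comp_primitive {Φ Φ' m k : ℝ → ℝ} {a b : ℝ}
    (hΦ : ∀ x, HasDerivAt Φ (Φ' x) x) (hΦ' : Continuous Φ') (hm : IsPrimitive m k a b) :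
    AbsolutelyContinuousOnInterval (fun t => Φ (m t)) a b ∧
    ∫ t in a..b, Φ' (m t) * k t = Φ (m b) - Φ (m a) := by
  have hmc := hm.continuousOn
  obtain ⟨R, hR⟩ := (isCompact_uIcc.image_of_continuousOn hmc).isBounded.subset_closedBall 0
  obtain ⟨K, hK⟩ := ((isCompact_closedBall (0 : ℝ) R).bddAbove_image hΦ'.norm.continuousOn)
  have hac : AbsolutelyContinuousOnInterval (fun t => Φ (m t)) a b := by
    refine absolutelyContinuousOnInterval_of_dist_le K hm.absolutelyContinuous
      hm.absolutelyContinuous fun s hs t ht => ?_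
    have hK0 : 0 ≤ K := (norm_nonneg _).trans
      (hK (mem_image_of_mem _ (hR (mem_image_of_mem m hs))))
    have := (convex_closedBall (0 : ℝ) R).norm_image_sub_le_of_norm_hasDerivWithin_le
      (f := Φ) (f' := Φ') (C := K) (fun x _ => (hΦ x).hasDerivWithinAt)
      (fun x hx => hK (mem_image_of_mem _ hx)) (hR (mem_image_of_mem m ht))
      (hR (mem_image_of_mem m hs))
    rw [dist_eq_norm, dist_eq_norm]
    nlinarith [norm_nonneg (m s - m t)]
  refine ⟨hac, ?_⟩
  rw [← hac.integral_deriv_eq_sub]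
  refine intervalIntegral.integral_congr_ae ?_
  filter_upwards [hm.ae_hasDerivAt] with t ht hmem
  exact ((hΦ (m t)).comp t (ht (uIoc_subset_uIcc hmem))).deriv.symm

/-- Grönwall's inequality with an integrable kernel. -/
theorem le_mul_exp_of_le_add_integral {u k : ℝ → ℝ} {a b e : ℝ} (hab : a ≤ b)
    (hk : IntervalIntegrable k volume a b) (hk0 : ∀ r ∈ Icc a b, 0 ≤ k r)
    (hu : ContinuousOn u (Icc a b))
    (h : ∀ t ∈ Icc a b, u t ≤ e + ∫ r in a..t, k r * u r) :
    u b ≤ e * Real.exp (∫ r in a..b, k r) := by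
  rw [← uIcc_of_le hab] at hk0 hu h
  have hku : IntervalIntegrable (fun r => k r * u r) volume a b := hk.mul_continuousOn hu
  set m : ℝ → ℝ := fun t => ∫ r in a..t, k r with hm
  set U : ℝ → ℝ := fun t => e + ∫ r in a..t, k r * u r with hU
  have hmp : IsPrimitive m k a b :=
    IsPrimitive.of_eq_add left_mem_uIcc hk 0 fun t _ => by simp [hm]
  have hUp : IsPrimitive U (fun r => k r * u r) a b :=
    IsPrimitive.of_eq_add left_mem_uIcc hku e fun t _ => rfl
  have hE := (integral_deriv_comp_primitive (Φ := fun x => Real.exp (-x))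
    (Φ' := fun x => -Real.exp (-x)) (fun x => by
      simpa using (hasDerivAt_neg x).exp) (by fun_prop) hmp).1
  have hV := hE.fun_mul hUp.absolutelyContinuous
  have hint := hV.integral_deriv_eq_sub
  have hle : ∫ t in a..b, deriv (fun t => Real.exp (-m t) * U t) t ≤ 0 := by
    have : ∫ t in a..b, deriv (fun t => Real.exp (-m t) * U t) t ≤ ∫ t in a..b, (0 : ℝ) := by
      refine intervalIntegral.integral_mono_ae_restrict hab hV.intervalIntegrable_deriv
        intervalIntegrable_const ?_
      rw [← uIcc_of_le hab]
      refine (ae_restrict_iff' measurableSet_uIcc).mpr ?_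
      filter_upwards [hmp.ae_hasDerivAt, hUp.ae_hasDerivAt] with t h1 h2 ht
      have hd := (h1 ht).fun_neg.exp.fun_mul (h2 ht)
      have : deriv (fun t => Real.exp (-m t) * U t) t =
          Real.exp (-m t) * (k t * (u t - U t)) := by
        refine Eq.trans hd.deriv ?_
        ring
      rw [this]
      exact mul_nonpos_of_nonneg_of_nonpos (Real.exp_pos _).le
        (mul_nonpos_of_nonneg_of_nonpos (hk0 t ht) (by linarith [h t ht]))
    simpa using this
  rw [hint] at hle
  have hUb := h b right_mem_uIcc
  have ha : Real.exp (-m a) * U a = e := by simp [hm, hU]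
  rw [ha] at hle
  calc u b ≤ U b := hUb
    _ = (Real.exp (-m b) * U b) * Real.exp (m b) := by
      rw [mul_comm, ← mul_assoc, ← Real.exp_add]; simp
    _ ≤ e * Real.exp (m b) := by gcongr; linarith

/-- Grönwall's inequality with an integrable kernel, forward or backward in time. -/
theorem le_mul_exp_of_le_add_abs_integral {u k : ℝ → ℝ} {a b e : ℝ}
    (hk : IntervalIntegrable k volume a b) (hk0 : ∀ r ∈ uIcc a b, 0 ≤ k r)
    (hu : ContinuousOn u (uIcc a b)) (hu0 : ∀ r ∈ uIcc a b, 0 ≤ u r)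
    (h : ∀ t ∈ uIcc a b, u t ≤ e + |∫ r in a..t, k r * u r|) :
    u b ≤ e * Real.exp |∫ r in a..b, k r| := by
  rcases le_total a b with hab | hab
  · rw [uIcc_of_le hab] at *
    rw [abs_of_nonneg (intervalIntegral.integral_nonneg hab hk0)]
    refine le_mul_exp_of_le_add_integral hab hk hk0 hu fun t ht => ?_
    refine (h t ht).trans_eq ?_
    rw [abs_of_nonneg (intervalIntegral.integral_nonneg ht.1 fun r hr => ?_)]
    have hr' : r ∈ Icc a b := ⟨hr.1, hr.2.trans ht.2⟩
    exact mul_nonneg (hk0 r hr') (hu0 r hr')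
  · rw [uIcc_of_ge hab] at *
    have hmem : ∀ t ∈ Icc (-a) (-b), -t ∈ Icc b a := fun t ht => ⟨by linarith [ht.2], by
      linarith [ht.1]⟩
    have hab' : -a ≤ -b := by linarith
    have key := le_mul_exp_of_le_add_integral (u := fun t => u (-t)) (k := fun t => k (-t))
      (a := -a) (b := -b) (e := e) hab' (by simpa using (hk.comp_sub_left 0))
      (fun r hr => hk0 _ (hmem r hr)) (hu.comp continuous_neg.continuousOn hmem) fun t ht => by
        refine (h _ (hmem t ht)).trans_eq ?_
        rw [intervalIntegral.integral_comp_neg (fun r => k r * u r), neg_neg,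
          intervalIntegral.integral_symm, abs_neg, abs_of_nonneg]
        refine intervalIntegral.integral_nonneg (hmem t ht).2 fun r hr => ?_
        have hr' : r ∈ Icc b a := ⟨(hmem t ht).1.trans hr.1, hr.2⟩
        exact mul_nonneg (hk0 r hr') (hu0 r hr')
    rw [intervalIntegral.integral_comp_neg k, neg_neg, neg_neg] at key
    rwa [intervalIntegral.integral_symm, abs_neg,
      abs_of_nonneg (intervalIntegral.integral_nonneg hab hk0)]

/-- A linear integral equation `u(t) = e + ∫₀ᵗ L_r u(r) dr` with integrable coefficients has a
continuous solution, the sum of its Neumann series. -/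
theorem exists_linear_integral_equation {E : Type*} [NormedAddCommGroup E] [NormedSpace ℝ E]
    [CompleteSpace E] {L : ℝ → E →L[ℝ] E} {k : ℝ → ℝ} (hk : IntegrableOn k (Icc 0 1))
    (hL : AEStronglyMeasurable L (volume.restrict (Icc (0 : ℝ) 1)))
    (hLk : ∀ r ∈ Icc (0 : ℝ) 1, ‖L r‖ ≤ k r)
    (e : E) :
    ∃ u : ℝ → E, IsPrimitive u (fun r => L r (u r)) 0 1 ∧ u 0 = e := by
  let A : ℕ → ℝ → E := fun n => Nat.rec (fun _ => e) (fun _ f t => ∫ r in (0 : ℝ)..t, L r (f r)) n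
  have hA0 : A 0 = fun _ => e := rfl
  have hAs : ∀ n t, A (n + 1) t = ∫ r in (0 : ℝ)..t, L r (A n r) := fun n t => rfl
  set m : ℝ → ℝ := fun t => ∫ r in (0 : ℝ)..t, k r with hm
  have hu01 : uIcc (0 : ℝ) 1 = Icc 0 1 := uIcc_of_le zero_le_one
  have hki : IntervalIntegrable k volume 0 1 := by
    rw [intervalIntegrable_iff_integrableOn_Icc_of_le zero_le_one]; exact hk
  have hmp : IsPrimitive m k 0 1 :=
    IsPrimitive.of_eq_add left_mem_uIcc hki 0 fun t _ => by simp [hm]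
  have hk0 : ∀ r ∈ Icc (0 : ℝ) 1, 0 ≤ k r := fun r hr => (norm_nonneg _).trans (hLk r hr)
  have hm0 : ∀ t ∈ Icc (0 : ℝ) 1, 0 ≤ m t := fun t ht =>
    intervalIntegral.integral_nonneg ht.1 fun r hr => hk0 r ⟨hr.1, hr.2.trans ht.2⟩
  -- the product of the coefficient with a continuous function is integrable
  have hint : ∀ f : ℝ → E, ContinuousOn f (Icc 0 1) →
      IntervalIntegrable (fun r => L r (f r)) volume 0 1 := by
    intro f hf
    rw [intervalIntegrable_iff_integrableOn_Icc_of_le zero_le_one]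
    obtain ⟨R, hR⟩ := (isCompact_Icc.bddAbove_image hf.norm)
    refine Integrable.mono' (hk.mul_const R)
      ((ContinuousLinearMap.id ℝ (E →L[ℝ] E)).aestronglyMeasurable_comp₂ hL
        (hf.aestronglyMeasurable measurableSet_Icc)) ?_
    refine (ae_restrict_iff' measurableSet_Icc).mpr (Eventually.of_forall fun r hr => ?_)
    refine ((L r).le_opNorm _).trans ?_
    exact mul_le_mul (hLk r hr) (hR (mem_image_of_mem _ hr)) (norm_nonneg _) (hk0 r hr)
  have hAc : ∀ n, ContinuousOn (A n) (Icc 0 1) := by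
    intro n
    induction n with
    | zero => exact continuousOn_const
    | succ n ih =>
      rw [← hu01]
      exact (IsPrimitive.of_eq_add left_mem_uIcc (hint _ ih) 0
        fun t _ => by rw [hAs, zero_add]).continuousOn
  have hAb : ∀ n, ∀ t ∈ Icc (0 : ℝ) 1, ‖A n t‖ ≤ ‖e‖ * (m t ^ n / n.factorial) := by
    intro n
    induction n with
    | zero => intro t _; simp [hA0]
    | succ n ih =>
      intro t ht
      have hmt : IsPrimitive m k 0 t := hmp.mono left_mem_uIcc (by rw [hu01]; exact ht)
      have hcv := (integral_deriv_comp_primitive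
        (Φ := fun x => ‖e‖ * (x ^ (n + 1) / (n + 1).factorial))
        (Φ' := fun x => ‖e‖ * (x ^ n / n.factorial)) (fun x => by
          have := ((hasDerivAt_pow (n + 1) x).div_const ((n + 1).factorial : ℝ)).const_mul ‖e‖
          refine this.congr_deriv ?_
          rw [Nat.factorial_succ]
          push_cast
          field_simp) (by fun_prop) hmt).2
      have hm00 : m 0 = 0 := by simp [hm]
      rw [hm00, zero_pow (Nat.succ_ne_zero n), zero_div, mul_zero, sub_zero] at hcv
      rw [hAs, ← hcv]
      refine intervalIntegral.norm_integral_le_of_norm_le ht.1 (Eventually.of_forall fun r hr => ?_)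
        (hmt.intervalIntegrable.continuousOn_mul ?_)
      · have hr' : r ∈ Icc (0 : ℝ) 1 := ⟨hr.1.le, hr.2.trans ht.2⟩
        refine ((L r).le_opNorm _).trans ?_
        rw [mul_comm]
        exact mul_le_mul (ih r hr') (hLk r hr') (norm_nonneg _)
          ((norm_nonneg _).trans (ih r hr'))
      · exact ((hmt.continuousOn.pow n).div_const _).const_mul _
  have hsumm : ∀ t, Summable fun n : ℕ => ‖e‖ * (m t ^ n / n.factorial) := fun t =>
    (Real.summable_pow_div_factorial (m t)).mul_left _
  have hAsum : ∀ t ∈ Icc (0 : ℝ) 1, Summable fun n => A n t := fun t ht =>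
    Summable.of_norm_bounded (hsumm t) fun n => hAb n t ht
  have hmono : ∀ t ∈ Icc (0 : ℝ) 1, m t ≤ m 1 := fun t ht => by
    have := hmp.sub_eq t (by rw [hu01]; exact ht) 1 right_mem_uIcc
    have h2 : 0 ≤ ∫ r in t..1, k r := intervalIntegral.integral_nonneg ht.2
      fun r hr => hk0 r ⟨ht.1.trans hr.1, hr.2⟩
    linarith
  refine ⟨fun t => ∑' n, A n t, ?_, ?_⟩
  · have hcont : ContinuousOn (fun t => ∑' n, A n t) (Icc 0 1) := by
      refine continuousOn_tsum hAc (hsumm 1) fun n t ht => (hAb n t ht).trans ?_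
      have := hm0 t ht
      have := hmono t ht
      gcongr
    refine IsPrimitive.of_eq_add left_mem_uIcc (hint _ hcont) e fun t ht => ?_
    rw [hu01] at ht
    rw [(hAsum t ht).tsum_eq_zero_add]
    congr 1
    have hsub : uIoc 0 t ⊆ Icc (0 : ℝ) 1 := by
      rw [uIoc_of_le ht.1]; exact fun r hr => ⟨hr.1.le, hr.2.trans ht.2⟩
    have hsubI : uIcc 0 t ⊆ uIcc (0 : ℝ) 1 := by
      rw [hu01, uIcc_of_le ht.1]; exact fun r hr => ⟨hr.1, hr.2.trans ht.2⟩
    refine (HasSum.tsum_eq ?_)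
    refine intervalIntegral.hasSum_integral_of_dominated_convergence
      (fun n r => k r * (‖e‖ * (m 1 ^ n / n.factorial))) (fun n => ?_) (fun n => ?_) ?_ ?_ ?_
    · exact ((hint _ (hAc n)).mono_set hsubI).aestronglyMeasurable_restrict_uIoc
    · refine Eventually.of_forall fun r hr => ?_
      have hr := hsub hr
      refine ((L r).le_opNorm _).trans (mul_le_mul (hLk r hr) ((hAb n r hr).trans ?_)
        (norm_nonneg _) (hk0 r hr))
      have := hm0 r hr
      have := hmono r hr
      gcongr
    · exact Eventually.of_forall fun r _ => (hsumm 1).mul_left _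
    · simp_rw [tsum_mul_left]
      exact (hki.mono_set hsubI).mul_const _
    · exact Eventually.of_forall fun r hr => (hAsum r (hsub hr)).hasSum.mapL (L r)
  · refine tsum_eq_single 0 fun n hn => ?_
    obtain ⟨n, rfl⟩ := Nat.exists_eq_succ_of_ne_zero hn
    simp [hAs]

/-! ### Flows of Carathéodory vector fields -/

/-- A time dependent vector field `X` over `[0, 1]` which vanishes off `U`, is differentiable on
`U`, and has at each time `r` the supremum and Lipschitz bound `k r`, with `k` integrable. The
last two fields say that `X` and its derivative are measurable in time along continuous curves. -/
structure IsCaratheodoryField {F : Type*} [NormedAddCommGroup F] [NormedSpace ℝ F]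
    (U : Set F) (X : ℝ → F → F) (k : ℝ → ℝ) : Prop where
  integrableOn : IntegrableOn k (Icc 0 1)
  norm_le : ∀ r x, ‖X r x‖ ≤ k r
  norm_sub_le : ∀ r x y, ‖X r x - X r y‖ ≤ k r * ‖x - y‖
  eq_zero : ∀ r, ∀ x ∉ U, X r x = 0
  differentiableAt : ∀ r, ∀ x ∈ U, DifferentiableAt ℝ (X r) x
  aestronglyMeasurable : ∀ γ : ℝ → F, ContinuousOn γ (Icc 0 1) →
    AEStronglyMeasurable (fun r => X r (γ r)) (volume.restrict (Icc (0 : ℝ) 1))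
  aestronglyMeasurable_fderiv : ∀ γ : ℝ → F, ContinuousOn γ (Icc 0 1) →
    MapsTo γ (Icc 0 1) U →
    AEStronglyMeasurable (fun r => fderiv ℝ (X r) (γ r)) (volume.restrict (Icc (0 : ℝ) 1))

/-- `γ` is an integral curve over `[0, 1]` of the time dependent vector field `X`. -/
abbrev IsTrajectory {F : Type*} [NormedAddCommGroup F] [NormedSpace ℝ F]
    (X : ℝ → F → F) (γ : ℝ → F) : Prop :=
  IsPrimitive γ (fun r => X r (γ r)) 0 1

/-- `φ s t` maps `x ∈ U` to the position at time `t` of a trajectory that is at `x` at time `s`. -/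
def IsFlowOf {F : Type*} [NormedAddCommGroup F] [NormedSpace ℝ F]
    (U : Set F) (X : ℝ → F → F) (φ : ℝ → ℝ → F → F) : Prop :=
  ∀ s ∈ Icc (0 : ℝ) 1, ∀ x ∈ U, IsTrajectory X (fun t => φ s t x) ∧ φ s s x = x

theorem uIcc_zero_one : uIcc (0 : ℝ) 1 = Icc 0 1 := uIcc_of_le zero_le_one

section

variable {F : Type*} [NormedAddCommGroup F] [NormedSpace ℝ F] {U : Set F} {X : ℝ → F → F}
  {k : ℝ → ℝ}

namespace IsCaratheodoryField

theorem nonneg (hX : IsCaratheodoryField U X k) (r : ℝ) : 0 ≤ k r :=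
  (norm_nonneg _).trans (hX.norm_le r 0)

theorem intervalIntegrable (hX : IsCaratheodoryField U X k) : IntervalIntegrable k volume 0 1 := by
  rw [intervalIntegrable_iff_integrableOn_Icc_of_le zero_le_one]; exact hX.integrableOn

theorem norm_fderiv_le (hX : IsCaratheodoryField U X k) (r : ℝ) (x : F) :
    ‖fderiv ℝ (X r) x‖ ≤ k r :=
  norm_fderiv_le_of_lip' ℝ (hX.nonneg r) (Eventually.of_forall fun y => hX.norm_sub_le r y x)

theorem abs_integral_le (hX : IsCaratheodoryField U X k) {c d : ℝ} (hc : c ∈ Icc (0 : ℝ) 1)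
    (hd : d ∈ Icc (0 : ℝ) 1) : |∫ r in c..d, k r| ≤ ∫ r in (0 : ℝ)..1, k r := by
  rw [intervalIntegral.abs_integral_eq_abs_integral_uIoc,
    intervalIntegral.integral_of_le zero_le_one,
    abs_of_nonneg (integral_nonneg fun r => hX.nonneg r)]
  refine setIntegral_mono_set (hX.integrableOn.mono_set Ioc_subset_Icc_self)
    (Eventually.of_forall fun r => hX.nonneg r) (LE.le.eventuallyLE ?_)
  exact fun r hr => ⟨lt_of_le_of_lt (le_min hc.1 hd.1) hr.1, hr.2.trans (max_le hc.2 hd.2)⟩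

/-- Grönwall's inequality with the constant `exp (∫₀¹ k)`, uniform over `[0, 1]`. -/
theorem le_mul_exp (hX : IsCaratheodoryField U X k) {u : ℝ → ℝ} {e c d : ℝ}
    (hc : c ∈ Icc (0 : ℝ) 1) (hd : d ∈ Icc (0 : ℝ) 1) (he : 0 ≤ e)
    (hu : ContinuousOn u (Icc 0 1)) (hu0 : ∀ r, 0 ≤ u r)
    (h : ∀ t ∈ Icc (0 : ℝ) 1, u t ≤ e + |∫ r in c..t, k r * u r|) :
    u d ≤ e * Real.exp (∫ r in (0 : ℝ)..1, k r) := by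
  have hsub : uIcc c d ⊆ Icc 0 1 := by
    rw [← uIcc_zero_one] at hc hd ⊢; exact uIcc_subset_uIcc hc hd
  refine (le_mul_exp_of_le_add_abs_integral (a := c) (b := d)
    (hX.intervalIntegrable.mono_set (by rwa [uIcc_zero_one])) (fun r _ => hX.nonneg r)
    (hu.mono hsub) (fun r _ => hu0 r) fun t ht => h t (hsub ht)).trans ?_
  gcongr
  exact hX.abs_integral_le hc hd

/-- Grönwall's inequality for the growth of a curve driven by a linear equation. -/
theorem norm_le_mul_exp {E : Type*} [NormedAddCommGroup E] [NormedSpace ℝ E]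
    (hX : IsCaratheodoryField U X k) {y y' : ℝ → E} (hy : IsPrimitive y y' 0 1)
    (hy' : ∀ r ∈ Icc (0 : ℝ) 1, ‖y' r‖ ≤ k r * ‖y r‖) {c d : ℝ} (hc : c ∈ Icc (0 : ℝ) 1)
    (hd : d ∈ Icc (0 : ℝ) 1) : ‖y d‖ ≤ ‖y c‖ * Real.exp (∫ r in (0 : ℝ)..1, k r) := by
  have hcont : ContinuousOn y (Icc 0 1) := by rw [← uIcc_zero_one]; exact hy.continuousOn
  refine hX.le_mul_exp (u := fun r => ‖y r‖) hc hd (norm_nonneg _) hcont.norm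
    (fun r => norm_nonneg _) fun t ht => ?_
  have hsub : uIcc c t ⊆ Icc 0 1 := by
    rw [← uIcc_zero_one] at hc ht ⊢; exact uIcc_subset_uIcc hc ht
  rw [← uIcc_zero_one] at hc ht
  have h1 : y t = y c + ∫ r in c..t, y' r := by rw [← hy.sub_eq c hc t ht]; abel
  rw [h1]
  refine (norm_add_le _ _).trans (add_le_add le_rfl ?_)
  refine intervalIntegral.norm_integral_le_abs_of_norm_le ?_ ?_
  · exact (ae_restrict_iff' measurableSet_uIoc).mpr
      (Eventually.of_forall fun r hr => hy' r (hsub (uIoc_subset_uIcc hr)))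
  · exact ((hX.intervalIntegrable.mono_set (by rwa [uIcc_zero_one])).mul_continuousOn
      (hcont.norm.mono hsub))

theorem norm_trajectory_sub_le (hX : IsCaratheodoryField U X k) {γ δ : ℝ → F}
    (hγ : IsTrajectory X γ) (hδ : IsTrajectory X δ) {c d : ℝ} (hc : c ∈ Icc (0 : ℝ) 1)
    (hd : d ∈ Icc (0 : ℝ) 1) :
    ‖γ d - δ d‖ ≤ ‖γ c - δ c‖ * Real.exp (∫ r in (0 : ℝ)..1, k r) := by
  refine hX.norm_le_mul_exp (y := fun r => γ r - δ r) (y' := fun r => X r (γ r) - X r (δ r))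
    ⟨hγ.intervalIntegrable.sub hδ.intervalIntegrable, fun s hs t ht => ?_⟩
    (fun r _ => hX.norm_sub_le r _ _) hc hd
  rw [intervalIntegral.integral_sub, ← hγ.sub_eq s hs t ht, ← hδ.sub_eq s hs t ht]
  · abel
  · exact hγ.intervalIntegrable.mono_set (uIcc_subset_uIcc hs ht)
  · exact hδ.intervalIntegrable.mono_set (uIcc_subset_uIcc hs ht)

theorem trajectory_eq (hX : IsCaratheodoryField U X k) {γ δ : ℝ → F}
    (hγ : IsTrajectory X γ) (hδ : IsTrajectory X δ) {c d : ℝ} (hc : c ∈ Icc (0 : ℝ) 1)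
    (hd : d ∈ Icc (0 : ℝ) 1) (h : γ c = δ c) : γ d = δ d := by
  have := hX.norm_trajectory_sub_le hγ hδ hc hd
  rw [h, sub_self, norm_zero, zero_mul] at this
  exact sub_eq_zero.mp (norm_le_zero_iff.mp this)

/-- Trajectories that start in `U` remain there, because the points off `U` are stationary. -/
theorem trajectory_mem (hX : IsCaratheodoryField U X k) {γ : ℝ → F}
    (hγ : IsTrajectory X γ) {c d : ℝ} (hc : c ∈ Icc (0 : ℝ) 1)
    (hd : d ∈ Icc (0 : ℝ) 1) (h : γ c ∈ U) : γ d ∈ U := by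
  by_contra hn
  have hz : IsTrajectory X (fun _ => γ d) := by
    have h0 : (fun r => X r (γ d)) = fun _ => 0 := funext fun r => hX.eq_zero r _ hn
    refine ⟨by rw [h0]; exact intervalIntegrable_const, fun s _ t _ => ?_⟩
    rw [h0]; simp
  have := hX.trajectory_eq hγ hz hd hc rfl
  exact hn (this ▸ h)

section flow

variable {φ : ℝ → ℝ → F → F}

theorem flow_mem (hX : IsCaratheodoryField U X k) (hφ : IsFlowOf U X φ) {s t : ℝ}
    (hs : s ∈ Icc (0 : ℝ) 1) (ht : t ∈ Icc (0 : ℝ) 1) {x : F} (hx : x ∈ U) : φ s t x ∈ U :=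
  hX.trajectory_mem (hφ s hs x hx).1 hs ht (by rw [(hφ s hs x hx).2]; exact hx)

theorem flow_comp (hX : IsCaratheodoryField U X k) (hφ : IsFlowOf U X φ) {s t r : ℝ}
    (hs : s ∈ Icc (0 : ℝ) 1) (ht : t ∈ Icc (0 : ℝ) 1) (hr : r ∈ Icc (0 : ℝ) 1) {x : F}
    (hx : x ∈ U) : φ t r (φ s t x) = φ s r x := by
  have hm := hX.flow_mem hφ hs ht hx
  exact hX.trajectory_eq (hφ t ht _ hm).1 (hφ s hs x hx).1 ht hr (hφ t ht _ hm).2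

theorem flow_inverse (hX : IsCaratheodoryField U X k) (hφ : IsFlowOf U X φ) {s t : ℝ}
    (hs : s ∈ Icc (0 : ℝ) 1) (ht : t ∈ Icc (0 : ℝ) 1) {x : F}
    (hx : x ∈ U) : φ t s (φ s t x) = x := by
  rw [hX.flow_comp hφ hs ht hs hx, (hφ s hs x hx).2]

theorem norm_flow_sub_le (hX : IsCaratheodoryField U X k) (hφ : IsFlowOf U X φ) {s t : ℝ}
    (hs : s ∈ Icc (0 : ℝ) 1) (ht : t ∈ Icc (0 : ℝ) 1) {x y : F} (hx : x ∈ U) (hy : y ∈ U) :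
    ‖φ s t x - φ s t y‖ ≤ ‖x - y‖ * Real.exp (∫ r in (0 : ℝ)..1, k r) := by
  have := hX.norm_trajectory_sub_le (hφ s hs x hx).1 (hφ s hs y hy).1 hs ht
  rwa [(hφ s hs x hx).2, (hφ s hs y hy).2] at this

theorem continuousOn_flow (hX : IsCaratheodoryField U X k) (hφ : IsFlowOf U X φ) {s t : ℝ}
    (hs : s ∈ Icc (0 : ℝ) 1) (ht : t ∈ Icc (0 : ℝ) 1) : ContinuousOn (φ s t) U := by
  refine LipschitzOnWith.continuousOn (K := (Real.exp (∫ r in (0 : ℝ)..1, k r)).toNNReal)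
    (LipschitzOnWith.of_dist_le_mul fun x hx y hy => ?_)
  rw [Real.coe_toNNReal _ (Real.exp_pos _).le, dist_eq_norm, dist_eq_norm, mul_comm]
  exact hX.norm_flow_sub_le hφ hs ht hx hy

end flow

end IsCaratheodoryField

/-- `A` and `B` solve the variational equation of `X` along `γ` and its inverse equation:
`A' = dX(γ) A` and `B' = -B dX(γ)`, both starting from the identity at time `0`. -/
structure IsPropagator (X : ℝ → F → F) (γ : ℝ → F) (A B : ℝ → F →L[ℝ] F) : Prop where
  left : IsPrimitive A (fun r => fderiv ℝ (X r) (γ r) * A r) 0 1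
  left_zero : A 0 = 1
  right : IsPrimitive B (fun r => -(B r * fderiv ℝ (X r) (γ r))) 0 1
  right_zero : B 0 = 1

theorem IsCaratheodoryField.exists_isPropagator [CompleteSpace F] (hX : IsCaratheodoryField U X k)
    {γ : ℝ → F} (hγ : ContinuousOn γ (Icc 0 1)) (hγU : MapsTo γ (Icc 0 1) U) :
    ∃ A B, IsPropagator X γ A B := by
  have hm := hX.aestronglyMeasurable_fderiv γ hγ hγU
  obtain ⟨A, hA, hA0⟩ := exists_linear_integral_equation
    (L := fun r => ContinuousLinearMap.mul ℝ (F →L[ℝ] F) (fderiv ℝ (X r) (γ r)))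
    hX.integrableOn
    ((ContinuousLinearMap.mul ℝ (F →L[ℝ] F)).continuous.comp_aestronglyMeasurable hm)
    (fun r _ => (ContinuousLinearMap.opNorm_mul_apply_le ℝ _ _).trans (hX.norm_fderiv_le r _)) 1
  obtain ⟨B, hB, hB0⟩ := exists_linear_integral_equation
    (L := fun r => -(ContinuousLinearMap.mul ℝ (F →L[ℝ] F)).flip (fderiv ℝ (X r) (γ r)))
    hX.integrableOn
    (((ContinuousLinearMap.mul ℝ (F →L[ℝ] F)).flip.continuous.comp_aestronglyMeasurable hm).neg)
    (fun r _ => by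
      rw [norm_neg]
      refine (ContinuousLinearMap.opNorm_le_bound _ (norm_nonneg _) fun T => ?_).trans
        (hX.norm_fderiv_le r (γ r))
      rw [ContinuousLinearMap.flip_apply, ContinuousLinearMap.mul_apply', mul_comm]
      exact norm_mul_le _ _) 1
  exact ⟨A, B, hA, hA0, hB, hB0⟩

namespace IsPropagator

variable {γ : ℝ → F} {A B : ℝ → F →L[ℝ] F}

theorem norm_left_le (h : IsPropagator X γ A B) (hX : IsCaratheodoryField U X k) {t : ℝ}
    (ht : t ∈ Icc (0 : ℝ) 1) : ‖A t‖ ≤ Real.exp (∫ r in (0 : ℝ)..1, k r) := by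
  have := hX.norm_le_mul_exp h.left (fun r _ => (norm_mul_le _ _).trans
    (mul_le_mul_of_nonneg_right (hX.norm_fderiv_le r _) (norm_nonneg _)))
    (left_mem_Icc.mpr zero_le_one) ht
  rw [h.left_zero] at this
  refine this.trans (mul_le_of_le_one_left (Real.exp_pos _).le ContinuousLinearMap.norm_id_le)

theorem norm_right_le (h : IsPropagator X γ A B) (hX : IsCaratheodoryField U X k) {t : ℝ}
    (ht : t ∈ Icc (0 : ℝ) 1) : ‖B t‖ ≤ Real.exp (∫ r in (0 : ℝ)..1, k r) := by
  have := hX.norm_le_mul_exp h.right (fun r _ => by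
    rw [norm_neg, mul_comm]
    exact (norm_mul_le _ _).trans
      (mul_le_mul_of_nonneg_left (hX.norm_fderiv_le r _) (norm_nonneg _)))
    (left_mem_Icc.mpr zero_le_one) ht
  rw [h.right_zero] at this
  refine this.trans (mul_le_of_le_one_left (Real.exp_pos _).le ContinuousLinearMap.norm_id_le)

/-- The product `B A` has derivative `-B dX A + B dX A = 0`. -/
theorem right_mul_left [CompleteSpace F] (h : IsPropagator X γ A B)
    (hX : IsCaratheodoryField U X k) {t : ℝ} (ht : t ∈ Icc (0 : ℝ) 1) : B t * A t = 1 := by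
  have hac : AbsolutelyContinuousOnInterval (fun r => B r * A r) 0 1 := by
    refine absolutelyContinuousOnInterval_of_dist_le (Real.exp (∫ r in (0 : ℝ)..1, k r))
      h.right.absolutelyContinuous h.left.absolutelyContinuous fun s hs t ht => ?_
    rw [uIcc_zero_one] at hs ht
    simp only [dist_eq_norm]
    have e : B s * A s - B t * A t = (B s - B t) * A s + B t * (A s - A t) := by noncomm_ring
    rw [e]
    refine (norm_add_le _ _).trans ?_
    have h1 := (norm_mul_le (B s - B t) (A s)).trans
      (mul_le_mul_of_nonneg_left (h.norm_left_le hX hs) (norm_nonneg _))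
    have h2 := (norm_mul_le (B t) (A s - A t)).trans
      (mul_le_mul_of_nonneg_right (h.norm_right_le hX ht) (norm_nonneg _))
    linarith
  obtain ⟨C, hC⟩ := hac.const_of_ae_hasDerivAt_zero (by
    filter_upwards [h.right.ae_hasDerivAt, h.left.ae_hasDerivAt] with r hB hA hr
    have := (hB hr).mul (hA hr)
    refine this.congr_deriv ?_
    noncomm_ring)
  rw [uIcc_zero_one] at hC
  rw [hC t ht, ← hC 0 (left_mem_Icc.mpr zero_le_one), h.left_zero, h.right_zero, one_mul]

theorem left_mul_right [FiniteDimensional ℝ F] (h : IsPropagator X γ A B)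
    (hX : IsCaratheodoryField U X k) {t : ℝ} (ht : t ∈ Icc (0 : ℝ) 1) : A t * B t = 1 := by
  have : CompleteSpace F := FiniteDimensional.complete ℝ F
  have h1 := h.right_mul_left hX ht
  have h2 : (B t : F →ₗ[ℝ] F) * (A t : F →ₗ[ℝ] F) = 1 := by
    ext v; exact congrArg (fun T : F →L[ℝ] F => T v) h1
  rw [mul_eq_one_comm] at h2
  ext v; exact congrArg (fun T : F →ₗ[ℝ] F => T v) h2

theorem inverse_left [FiniteDimensional ℝ F] (h : IsPropagator X γ A B)
    (hX : IsCaratheodoryField U X k) {t : ℝ} (ht : t ∈ Icc (0 : ℝ) 1) : (A t).inverse = B t :=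
  have : CompleteSpace F := FiniteDimensional.complete ℝ F
  ContinuousLinearMap.inverse_eq (h.left_mul_right hX ht) (h.right_mul_left hX ht)

end IsPropagator

/-- The flow is differentiable in the starting point, and its derivative solves the variational
equation. -/
theorem IsPropagator.hasFDerivAt_flow [CompleteSpace F] {φ : ℝ → ℝ → F → F}
    {A B : ℝ → F →L[ℝ] F} {x : F} (h : IsPropagator X (fun r => φ 0 r x) A B)
    (hX : IsCaratheodoryField U X k) (hU : IsOpen U) (hφ : IsFlowOf U X φ) (hx : x ∈ U) {t : ℝ}
    (ht : t ∈ Icc (0 : ℝ) 1) : HasFDerivAt (φ 0 t) (A t) x := by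
  have h0 : (0 : ℝ) ∈ Icc (0 : ℝ) 1 := left_mem_Icc.mpr zero_le_one
  set M := Real.exp (∫ r in (0 : ℝ)..1, k r) with hM
  have hcφ : ∀ y ∈ U, ContinuousOn (fun r => φ 0 r y) (Icc 0 1) := fun y hy => by
    rw [← uIcc_zero_one]; exact (hφ 0 h0 y hy).1.continuousOn
  set D : ℝ → F →L[ℝ] F := fun r => fderiv ℝ (X r) (φ 0 r x) with hD
  have hDm : AEStronglyMeasurable D (volume.restrict (Icc (0 : ℝ) 1)) :=
    hX.aestronglyMeasurable_fderiv _ (hcφ x hx) fun r hr => hX.flow_mem hφ h0 hr hx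
  -- the remainder of the first order expansion of the field along the trajectory of `x`
  set R : F → ℝ → F := fun y r =>
    X r (φ 0 r y) - X r (φ 0 r x) - D r (φ 0 r y - φ 0 r x) with hR
  have hRm : ∀ y ∈ U, AEStronglyMeasurable (R y) (volume.restrict (Icc (0 : ℝ) 1)) := by
    intro y hy
    refine ((hX.aestronglyMeasurable _ (hcφ y hy)).sub
      (hX.aestronglyMeasurable _ (hcφ x hx))).sub ?_
    exact (ContinuousLinearMap.id ℝ (F →L[ℝ] F)).aestronglyMeasurable_comp₂ hDm
      (((hcφ y hy).sub (hcφ x hx)).aestronglyMeasurable measurableSet_Icc)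
  have hRb : ∀ y ∈ U, ∀ r ∈ Icc (0 : ℝ) 1, ‖R y r‖ ≤ 2 * k r * (‖y - x‖ * M) := by
    intro y hy r hr
    have h1 := hX.norm_sub_le r (φ 0 r y) (φ 0 r x)
    have h2 := (D r).le_of_opNorm_le (hX.norm_fderiv_le r _) (φ 0 r y - φ 0 r x)
    have h3 := mul_le_mul_of_nonneg_left (hX.norm_flow_sub_le hφ h0 hr hy hx) (hX.nonneg r)
    have h4 := norm_sub_le (X r (φ 0 r y) - X r (φ 0 r x)) (D r (φ 0 r y - φ 0 r x))
    simp only [hR]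
    linarith
  have hRi : ∀ y ∈ U, IntervalIntegrable (R y) volume 0 1 := by
    intro y hy
    rw [intervalIntegrable_iff_integrableOn_Icc_of_le zero_le_one]
    refine Integrable.mono' ((hX.integrableOn.const_mul 2).mul_const (‖y - x‖ * M)) (hRm y hy) ?_
    exact (ae_restrict_iff' measurableSet_Icc).mpr (Eventually.of_forall (hRb y hy))
  have hUx : ∀ᶠ y in 𝓝 x, y ∈ U := hU.mem_nhds hx
  set ρ : F → ℝ := fun y => ∫ r in (0 : ℝ)..1, ‖R y r‖ with hρ
  have hδ : ∀ y ∈ U, ‖φ 0 t y - φ 0 t x - A t (y - x)‖ ≤ ρ y * M := by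
    intro y hy
    have hAc : ContinuousOn A (Icc 0 1) := by rw [← uIcc_zero_one]; exact h.left.continuousOn
    have hδc : ContinuousOn (fun r => φ 0 r y - φ 0 r x - A r (y - x)) (Icc 0 1) :=
      ((hcφ y hy).sub (hcφ x hx)).sub (hAc.clm_apply continuousOn_const)
    refine hX.le_mul_exp (u := fun r => ‖φ 0 r y - φ 0 r x - A r (y - x)‖) h0 ht
      (intervalIntegral.integral_nonneg zero_le_one fun r _ => norm_nonneg _) hδc.norm
      (fun r => norm_nonneg _) fun s hs => ?_
    have hs' : s ∈ uIcc (0 : ℝ) 1 := by rw [uIcc_zero_one]; exact hs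
    have hsub : uIcc 0 s ⊆ uIcc (0 : ℝ) 1 := uIcc_subset_uIcc left_mem_uIcc hs'
    have iy := (hφ 0 h0 y hy).1.intervalIntegrable.mono_set hsub
    have ix := (hφ 0 h0 x hx).1.intervalIntegrable.mono_set hsub
    have iA := h.left.intervalIntegrable.mono_set hsub
    have ey := (hφ 0 h0 y hy).1.sub_eq 0 left_mem_uIcc s hs'
    have ex := (hφ 0 h0 x hx).1.sub_eq 0 left_mem_uIcc s hs'
    have eA := h.left.sub_eq 0 left_mem_uIcc s hs'
    rw [(hφ 0 h0 y hy).2] at ey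
    rw [(hφ 0 h0 x hx).2] at ex
    rw [h.left_zero] at eA
    have iA' : IntervalIntegrable (fun r => (fderiv ℝ (X r) (φ 0 r x) * A r) (y - x))
        volume 0 s :=
      ⟨(ContinuousLinearMap.apply ℝ F (y - x)).integrable_comp iA.1,
        (ContinuousLinearMap.apply ℝ F (y - x)).integrable_comp iA.2⟩
    have eA' : A s (y - x) = (y - x) +
        ∫ r in (0 : ℝ)..s, (fderiv ℝ (X r) (φ 0 r x) * A r) (y - x) := by
      rw [← ContinuousLinearMap.intervalIntegral_apply iA, ← eA]
      simp
    have e : φ 0 s y - φ 0 s x - A s (y - x) = (∫ r in (0 : ℝ)..s, R y r) +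
        ∫ r in (0 : ℝ)..s, D r (φ 0 r y - φ 0 r x - A r (y - x)) := by
      have iδ : IntervalIntegrable (fun r => D r (φ 0 r y - φ 0 r x - A r (y - x))) volume 0 s := by
        refine (((iy.sub ix).sub iA').sub ((hRi y hy).mono_set hsub)).congr_ae ?_
        refine Eventually.of_forall fun r => ?_
        simp only [hR, hD, map_sub, mul_apply_eq_comp]
        abel
      rw [← intervalIntegral.integral_add ((hRi y hy).mono_set hsub) iδ, eA',
        sub_eq_iff_eq_add.mp ey, sub_eq_iff_eq_add.mp ex]
      have e2 : ∀ r, R y r + D r (φ 0 r y - φ 0 r x - A r (y - x)) =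
          (X r (φ 0 r y) - X r (φ 0 r x)) - (fderiv ℝ (X r) (φ 0 r x) * A r) (y - x) := by
        intro r
        simp only [hR, hD, map_sub, mul_apply_eq_comp]
        abel
      simp_rw [e2]
      rw [intervalIntegral.integral_sub (iy.sub ix) iA', intervalIntegral.integral_sub iy ix]
      abel
    rw [e]
    refine (norm_add_le _ _).trans (add_le_add ?_ ?_)
    · refine (intervalIntegral.norm_integral_le_integral_norm hs.1).trans ?_
      exact intervalIntegral.integral_mono_interval le_rfl hs.1 hs.2
        (Eventually.of_forall fun r => norm_nonneg _) (hRi y hy).norm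
    · refine intervalIntegral.norm_integral_le_abs_of_norm_le
        (Eventually.of_forall fun r => (D r).le_of_opNorm_le (hX.norm_fderiv_le r _) _) ?_
      exact (hX.intervalIntegrable.mono_set hsub).mul_continuousOn
        (hδc.norm.mono (by rwa [uIcc_zero_one] at hsub))
  -- the remainder is negligible at each time, hence so is its integral, by dominated convergence
  have hρo : ρ =o[𝓝 x] fun y => ‖y - x‖ := by
    refine Asymptotics.isLittleO_of_tendsto (fun y hy => ?_) ?_
    · rw [norm_eq_zero, sub_eq_zero] at hy
      simp [hρ, hR, hy]
    · have hlim : Tendsto (fun y => ∫ r in (0 : ℝ)..1, ‖R y r‖ / ‖y - x‖) (𝓝 x)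
          (𝓝 (∫ r in (0 : ℝ)..1, (0 : ℝ))) := by
        refine intervalIntegral.tendsto_integral_filter_of_dominated_convergence
          (fun r => 2 * k r * M) ?_ ?_ ((hX.intervalIntegrable.const_mul 2).mul_const M) ?_
        · filter_upwards [hUx] with y hy
          exact ((hRi y hy).norm.div_const _).aestronglyMeasurable_restrict_uIoc
        · filter_upwards [hUx] with y hy
          refine Eventually.of_forall fun r hr => ?_
          have hr : r ∈ Icc (0 : ℝ) 1 := by rw [← uIcc_zero_one]; exact uIoc_subset_uIcc hr
          rw [norm_div, norm_norm, norm_norm]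
          refine div_le_of_le_mul₀ (norm_nonneg _) ?_ ((hRb y hy r hr).trans_eq (by ring))
          have := hX.nonneg r
          positivity
        · refine Eventually.of_forall fun r hr => ?_
          have hr : r ∈ Icc (0 : ℝ) 1 := by rw [← uIcc_zero_one]; exact uIoc_subset_uIcc hr
          have hc : ContinuousAt (φ 0 r) x :=
            (hX.continuousOn_flow hφ h0 hr).continuousAt (hU.mem_nhds hx)
          have h1 := ((hX.differentiableAt r _
            (hX.flow_mem hφ h0 hr hx)).hasFDerivAt.isLittleO).comp_tendsto hc
          have h2 : (fun y => φ 0 r y - φ 0 r x) =O[𝓝 x] fun y => y - x := by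
            refine Asymptotics.IsBigO.of_bound M ?_
            filter_upwards [hUx] with y hy
            rw [mul_comm]
            exact hX.norm_flow_sub_le hφ h0 hr hy hx
          exact (h1.trans_isBigO h2).norm_norm.tendsto_div_nhds_zero
      simpa [hρ, intervalIntegral.integral_div] using hlim
  refine HasFDerivAt.of_isLittleO ?_
  refine Asymptotics.IsBigO.trans_isLittleO (Asymptotics.IsBigO.of_bound M ?_) hρo.of_norm_right
  filter_upwards [hUx] with y hy
  rw [mul_comm]
  exact (hδ y hy).trans (mul_le_mul_of_nonneg_right (le_abs_self _) (Real.exp_pos _).le)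

end

/-! ### Transport of vector fields and conservation of the energy -/

section

variable {F : Type*} [NormedAddCommGroup F] [NormedSpace ℝ F] [FiniteDimensional ℝ F]
  {U : Set F} {X : ℝ → F → F} {k : ℝ → ℝ} {φ : ℝ → ℝ → F → F}

/-- The pullback `(dφ_{0,t})⁻¹ h(φ_{0,t})` of a vector field `h` along the flow of `X` is absolutely
continuous in `t` with derivative `(dφ_{0,t})⁻¹ [dh X_t - dX_t h](φ_{0,t})`, so a bound on the
Lie bracket bounds its increments. -/
theorem IsCaratheodoryField.norm_pullback_sub_le (hX : IsCaratheodoryField U X k) (hU : IsOpen U)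
    (hφ : IsFlowOf U X φ) {x : F} (hx : x ∈ U) {h : F → F} {c : ℝ}
    (hc : ∀ y, ‖h y‖ ≤ c) (hlip : ∀ y z, ‖h y - h z‖ ≤ c * ‖y - z‖)
    (hd : ∀ y ∈ U, DifferentiableAt ℝ h y) {s t D : ℝ} (hs : s ∈ Icc (0 : ℝ) 1)
    (ht : t ∈ Icc (0 : ℝ) 1)
    (hD : ∀ᵐ r, r ∈ uIcc s t → ∀ z ∈ U,
      ‖fderiv ℝ h z (X r z) - fderiv ℝ (X r) z (h z)‖ ≤ D) :
    ‖(fderiv ℝ (φ 0 t) x).inverse (h (φ 0 t x)) - (fderiv ℝ (φ 0 s) x).inverse (h (φ 0 s x))‖ ≤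
      Real.exp (∫ r in (0 : ℝ)..1, k r) * D * |t - s| := by
  have : CompleteSpace F := FiniteDimensional.complete ℝ F
  have h0 : (0 : ℝ) ∈ Icc (0 : ℝ) 1 := left_mem_Icc.mpr zero_le_one
  have hγ := (hφ 0 h0 x hx).1
  obtain ⟨A, B, hAB⟩ := hX.exists_isPropagator (γ := fun r => φ 0 r x)
    (by rw [← uIcc_zero_one]; exact hγ.continuousOn) fun r hr => hX.flow_mem hφ h0 hr hx
  have hinv : ∀ r ∈ Icc (0 : ℝ) 1, (fderiv ℝ (φ 0 r) x).inverse = B r := fun r hr => by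
    rw [(hAB.hasFDerivAt_flow hX hU hφ hx hr).fderiv, hAB.inverse_left hX hr]
  rw [hinv t ht, hinv s hs]
  have hs' : s ∈ uIcc (0 : ℝ) 1 := by rwa [uIcc_zero_one]
  have ht' : t ∈ uIcc (0 : ℝ) 1 := by rwa [uIcc_zero_one]
  have hsub : uIcc s t ⊆ Icc 0 1 := by rw [← uIcc_zero_one]; exact uIcc_subset_uIcc hs' ht'
  have hBp := hAB.right.mono hs' ht'
  have hγp := hγ.mono hs' ht'
  set M := Real.exp (∫ r in (0 : ℝ)..1, k r) with hM
  have hM0 : 0 < M := Real.exp_pos _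
  have hac : AbsolutelyContinuousOnInterval (fun r => B r (h (φ 0 r x))) s t := by
    refine absolutelyContinuousOnInterval_of_dist_le (c + M * c) hBp.absolutelyContinuous
      hγp.absolutelyContinuous fun p hp q hq => ?_
    simp only [dist_eq_norm]
    have e : B p (h (φ 0 p x)) - B q (h (φ 0 q x)) =
        (B p - B q) (h (φ 0 p x)) + B q (h (φ 0 p x) - h (φ 0 q x)) := by
      simp
    rw [e]
    refine (norm_add_le _ _).trans ?_
    have hc0 : 0 ≤ c := (norm_nonneg _).trans (hc x)
    have h1 := ((B p - B q).le_opNorm (h (φ 0 p x))).trans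
      (mul_le_mul_of_nonneg_left (hc _) (norm_nonneg _))
    have h2 := ((B q).le_of_opNorm_le (hAB.norm_right_le hX (hsub hq))
      (h (φ 0 p x) - h (φ 0 q x))).trans (mul_le_mul_of_nonneg_left (hlip _ _) hM0.le)
    have h3 : 0 ≤ c * ‖φ 0 p x - φ 0 q x‖ := by positivity
    have h4 : 0 ≤ M * c * ‖B p - B q‖ := by positivity
    linarith
  refine norm_sub_le_of_ae_hasDerivAt hac
    (F' := fun r => B r (fderiv ℝ h (φ 0 r x) (X r (φ 0 r x)) -
      fderiv ℝ (X r) (φ 0 r x) (h (φ 0 r x)))) ?_ ?_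
  · filter_upwards [hBp.ae_hasDerivAt, hγp.ae_hasDerivAt] with r h1 h2 hr
    have hmem := hX.flow_mem hφ h0 (hsub hr) hx
    have h3 := (hd _ hmem).hasFDerivAt.comp_hasDerivAt r (h2 hr)
    refine ((h1 hr).clm_apply h3).congr_deriv ?_
    simp only [Function.comp, FunLike.coe_neg, Pi.neg_apply, mul_apply_eq_comp, map_sub]
    abel
  · filter_upwards [hD] with r h1 hr
    exact ((B r).le_of_opNorm_le (hAB.norm_right_le hX (hsub hr)) _).trans
      (mul_le_mul_of_nonneg_left (h1 hr _ (hX.flow_mem hφ h0 (hsub hr) hx)) hM0.le)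

theorem IsCaratheodoryField.exists_inverse_fderiv_flow (hX : IsCaratheodoryField U X k)
    (hU : IsOpen U) (hφ : IsFlowOf U X φ) {x : F} (hx : x ∈ U) {t : ℝ} (ht : t ∈ Icc (0 : ℝ) 1) :
    ∃ e : F ≃L[ℝ] F, HasFDerivAt (φ 0 t) (e : F →L[ℝ] F) x ∧
      ‖(e : F →L[ℝ] F)‖ ≤ Real.exp (∫ r in (0 : ℝ)..1, k r) ∧
      ‖(e.symm : F →L[ℝ] F)‖ ≤ Real.exp (∫ r in (0 : ℝ)..1, k r) := by
  have : CompleteSpace F := FiniteDimensional.complete ℝ F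
  have h0 : (0 : ℝ) ∈ Icc (0 : ℝ) 1 := left_mem_Icc.mpr zero_le_one
  obtain ⟨A, B, hAB⟩ := hX.exists_isPropagator (γ := fun r => φ 0 r x)
    (by rw [← uIcc_zero_one]; exact (hφ 0 h0 x hx).1.continuousOn)
    fun r hr => hX.flow_mem hφ h0 hr hx
  refine ⟨ContinuousLinearEquiv.equivOfInverse (A t) (B t)
    (fun v => congrArg (fun T : F →L[ℝ] F => T v) (hAB.right_mul_left hX ht))
    (fun v => congrArg (fun T : F →L[ℝ] F => T v) (hAB.left_mul_right hX ht)),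
    hAB.hasFDerivAt_flow hX hU hφ hx ht, hAB.norm_left_le hX ht, hAB.norm_right_le hX ht⟩

theorem IsCaratheodoryField.norm_inverse_fderiv_flow_le (hX : IsCaratheodoryField U X k)
    (hU : IsOpen U) (hφ : IsFlowOf U X φ) {x : F} (hx : x ∈ U) {t : ℝ} (ht : t ∈ Icc (0 : ℝ) 1) :
    ‖(fderiv ℝ (φ 0 t) x).inverse‖ ≤ Real.exp (∫ r in (0 : ℝ)..1, k r) := by
  obtain ⟨e, he, _, h⟩ := hX.exists_inverse_fderiv_flow hU hφ hx ht
  rwa [he.fderiv, ContinuousLinearMap.inverse_equiv]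

end

/-- A function whose increments are at most quadratic, on a subset of full measure in `[0, 1]`, is
constant there. -/
theorem eq_of_sub_le_sq {f : ℝ → ℝ} {G : Set ℝ} {C : ℝ} (hG : G ⊆ Icc 0 1)
    (hae : ∀ᵐ t ∂(volume.restrict (Icc (0 : ℝ) 1)), t ∈ G)
    (h : ∀ s ∈ G, ∀ t ∈ G, f t - f s ≤ C * |t - s| ^ 2) : ∀ s ∈ G, ∀ t ∈ G, f s = f t := by
  have h' : ∀ s ∈ G, ∀ t ∈ G, f t - f s ≤ |C| * |t - s| ^ 2 := fun s hs t ht =>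
    (h s hs t ht).trans (mul_le_mul_of_nonneg_right (le_abs_self C) (sq_nonneg _))
  have hdense : Icc (0 : ℝ) 1 ⊆ closure G := by
    rw [ae_restrict_iff' measurableSet_Icc] at hae
    have hd := Measure.dense_of_ae hae
    have h1 := hd.open_subset_closure_inter (isOpen_Ioo (a := (0 : ℝ)) (b := 1))
    rw [← closure_Ioo (zero_ne_one' ℝ)]
    refine closure_minimal (h1.trans (closure_mono ?_)) isClosed_closure
    exact fun t ht => ht.2 (Ioo_subset_Icc_self ht.1)
  have hlip : LipschitzOnWith |C|.toNNReal f G := by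
    refine LipschitzOnWith.of_dist_le_mul fun s hs t ht => ?_
    rw [Real.coe_toNNReal _ (abs_nonneg C), Real.dist_eq, Real.dist_eq]
    have hst : |s - t| ≤ 1 := by
      rw [abs_le]
      constructor <;> linarith [(hG hs).1, (hG hs).2, (hG ht).1, (hG ht).2]
    have hsq : |C| * |s - t| ^ 2 ≤ |C| * |s - t| :=
      mul_le_mul_of_nonneg_left (by nlinarith [abs_nonneg (s - t)]) (abs_nonneg C)
    refine abs_le.mpr ⟨?_, (h' t ht s hs).trans hsq⟩
    have := h' s hs t ht
    rw [abs_sub_comm] at this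
    linarith
  obtain ⟨g, hg, hfg⟩ := hlip.extend_real
  have hgc := hg.continuous
  have hquad : ∀ s ∈ Icc (0 : ℝ) 1, ∀ t ∈ Icc (0 : ℝ) 1, g t - g s ≤ |C| * |t - s| ^ 2 := by
    have hcl : IsClosed {p : ℝ × ℝ | g p.2 - g p.1 ≤ |C| * |p.2 - p.1| ^ 2} :=
      isClosed_le (by fun_prop) (by fun_prop)
    have hsub : G ×ˢ G ⊆ {p : ℝ × ℝ | g p.2 - g p.1 ≤ |C| * |p.2 - p.1| ^ 2} := by
      rintro ⟨s, t⟩ ⟨hs, ht⟩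
      simpa only [mem_ofPred_eq, ← hfg hs, ← hfg ht] using h' s hs t ht
    intro s hs t ht
    have hst : ((s, t) : ℝ × ℝ) ∈ closure (G ×ˢ G) := by
      rw [closure_prod_eq]; exact ⟨hdense hs, hdense ht⟩
    exact closure_minimal hsub hcl hst
  have hder : ∀ x ∈ Icc (0 : ℝ) 1, HasDerivWithinAt g 0 (Icc 0 1) x := by
    intro x hx
    rw [hasDerivWithinAt_iff_isLittleO]
    refine Asymptotics.IsBigO.trans_isLittleO (g := fun t => |t - x| ^ 2) ?_ ?_
    · refine Asymptotics.IsBigO.of_bound |C| ?_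
      filter_upwards [self_mem_nhdsWithin] with t ht
      rw [smul_zero, sub_zero, Real.norm_eq_abs, Real.norm_of_nonneg (sq_nonneg _)]
      refine abs_le.mpr ⟨?_, hquad x hx t ht⟩
      have := hquad t ht x hx
      rw [abs_sub_comm] at this
      linarith
    · exact (Asymptotics.isLittleO_pow_sub_sub x one_lt_two).mono nhdsWithin_le_nhds
  have hconst := constant_of_derivWithin_zero (f := g)
    (fun x hx => (hder x hx).differentiableWithinAt) fun x hx =>
      (hder x (Ico_subset_Icc_self hx)).derivWithin
        (uniqueDiffOn_Icc zero_lt_one x (Ico_subset_Icc_self hx))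
  intro s hs t ht
  rw [hfg hs, hfg ht, hconst s (hG hs), hconst t (hG ht)]

/-- Conservation of the energy. `G` is the set of times at which the velocity `w` is dual to the
transported momentum; the latter enters through its two bounds `hbound` and `hdiff` in terms of
the pullbacks `(dφ_{0,t})⁻¹ h(φ_{0,t})` of the fields `h : H`. Testing with `h = w_t + w_s` and
using that the Lie bracket of `w_r` with itself vanishes, the increments of `‖w_t‖²` are at most
quadratic in time. -/
theorem norm_sq_eq_of_momentum {F : Type*} [NormedAddCommGroup F] [InnerProductSpace ℝ F]
    [FiniteDimensional ℝ F] {U : Set F} (hU : IsOpen U) {H : Type*} [NormedAddCommGroup H]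
    [InnerProductSpace ℝ H] [RKHS ℝ H F F] {w : ℝ → H} {c : ℝ} (hc : 0 ≤ c)
    (hsup : ∀ (h : H) x, ‖h x‖ ≤ c * ‖h‖)
    (hlip : ∀ (h : H) x y, ‖h x - h y‖ ≤ c * ‖h‖ * ‖x - y‖)
    (hdif : ∀ (h : H), ∀ x ∈ U, DifferentiableAt ℝ h x)
    (hX : IsCaratheodoryField U (fun r => ⇑(w r)) fun r => c * ‖w r‖)
    {φ : ℝ → ℝ → F → F} (hφ : IsFlowOf U (fun r => ⇑(w r)) φ)
    {G : Set ℝ} (hG : G ⊆ Icc 0 1) (hae : ∀ᵐ t ∂(volume.restrict (Icc (0 : ℝ) 1)), t ∈ G)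
    {κ C : ℝ} (hκ : 0 < κ) (hC : 0 ≤ C)
    (hbound : ∀ t ∈ G, ∀ (h : H) (ε : ℝ), 0 ≤ ε →
      (∀ x ∈ U, ‖(fderiv ℝ (φ 0 t) x).inverse (h (φ 0 t x))‖ ≤ ε) → κ * ⟪w t, h⟫_ℝ ≤ C * ε)
    (hdiff : ∀ s ∈ G, ∀ t ∈ G, ∀ (h : H) (ε : ℝ), 0 ≤ ε →
      (∀ x ∈ U, ‖(fderiv ℝ (φ 0 t) x).inverse (h (φ 0 t x)) -
        (fderiv ℝ (φ 0 s) x).inverse (h (φ 0 s x))‖ ≤ ε) → κ * ⟪w t - w s, h⟫_ℝ ≤ C * ε) :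
    ∀ s ∈ G, ∀ t ∈ G, ‖w s‖ ^ 2 = ‖w t‖ ^ 2 := by
  set M := Real.exp (∫ r in (0 : ℝ)..1, c * ‖w r‖) with hM
  have hM0 : 0 < M := Real.exp_pos _
  have hfd : ∀ (h : H) x, ‖fderiv ℝ h x‖ ≤ c * ‖h‖ := fun h x =>
    norm_fderiv_le_of_lip' ℝ (by positivity) (Eventually.of_forall fun y => hlip h y x)
  have hself : ∀ {a b : ℝ}, 0 ≤ b → a * a ≤ b * a → a ≤ b := by
    intro a b hb hab
    by_contra! hlt
    nlinarith
  -- the velocities are bounded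
  obtain ⟨R, hR0, hR⟩ : ∃ R, 0 ≤ R ∧ ∀ t ∈ G, ‖w t‖ ≤ R := by
    refine ⟨C * M * c / κ, by positivity, fun t ht => hself (by positivity) ?_⟩
    have := hbound t ht (w t) (M * (c * ‖w t‖)) (by positivity) fun x hx =>
      (ContinuousLinearMap.le_of_opNorm_le _
        (hX.norm_inverse_fderiv_flow_le hU hφ hx (hG ht)) _).trans
        (mul_le_mul_of_nonneg_left (hsup _ _) hM0.le)
    rw [real_inner_self_eq_norm_mul_norm] at this
    rw [div_mul_eq_mul_div, le_div_iff₀ hκ]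
    linarith
  have hbr : ∀ (h u : H) z, ‖fderiv ℝ h z (u z) - fderiv ℝ u z (h z)‖ ≤ 2 * c ^ 2 * ‖h‖ * ‖u‖ := by
    intro h u z
    have h1 := ((fderiv ℝ h z).le_of_opNorm_le (hfd h z) (u z)).trans
      (mul_le_mul_of_nonneg_left (hsup u z) (by positivity))
    have h2 := ((fderiv ℝ u z).le_of_opNorm_le (hfd u z) (h z)).trans
      (mul_le_mul_of_nonneg_left (hsup h z) (by positivity))
    have h3 := norm_sub_le (fderiv ℝ h z (u z)) (fderiv ℝ u z (h z))
    nlinarith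
  have hae' := hae
  rw [ae_restrict_iff' measurableSet_Icc] at hae
  have hmem : ∀ {s t : ℝ}, s ∈ G → t ∈ G → uIcc s t ⊆ Icc 0 1 := by
    intro s t hs ht
    have hs := hG hs
    have ht := hG ht
    rw [← uIcc_zero_one] at hs ht ⊢
    exact uIcc_subset_uIcc hs ht
  -- the velocity is Lipschitz in time
  obtain ⟨K, hK0, hK⟩ : ∃ K, 0 ≤ K ∧ ∀ s ∈ G, ∀ t ∈ G, ‖w t - w s‖ ≤ K * |t - s| := by
    refine ⟨C * M * (2 * c ^ 2 * R) / κ, by positivity, fun s hs t ht => hself (by positivity) ?_⟩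
    have := hdiff s hs t ht (w t - w s) (M * (2 * c ^ 2 * ‖w t - w s‖ * R) * |t - s|)
      (by positivity) fun x hx => hX.norm_pullback_sub_le hU hφ hx (hsup _) (hlip _) (hdif _)
        (hG hs) (hG ht) (by
          filter_upwards [hae] with r hr hrst z _
          refine (hbr (w t - w s) (w r) z).trans ?_
          have := hR r (hr (hmem hs ht hrst))
          gcongr)
    rw [real_inner_self_eq_norm_mul_norm] at this
    rw [div_mul_eq_mul_div, div_mul_eq_mul_div, le_div_iff₀ hκ]
    linarith
  refine eq_of_sub_le_sq (f := fun t => ‖w t‖ ^ 2)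
    (C := C * M * (2 * c ^ 2 * (2 * K) * R) / κ) hG hae' fun s hs t ht => ?_
  have hsum : ⟪w t - w s, w t + w s⟫_ℝ = ‖w t‖ ^ 2 - ‖w s‖ ^ 2 := by
    rw [inner_sub_left, inner_add_right, inner_add_right, real_inner_self_eq_norm_sq,
      real_inner_self_eq_norm_sq, real_inner_comm (w t) (w s)]
    ring
  have := hdiff s hs t ht (w t + w s) (M * (2 * c ^ 2 * (2 * K * |t - s|) * R) * |t - s|)
    (by positivity) fun x hx => hX.norm_pullback_sub_le hU hφ hx (hsup _) (hlip _) (hdif _)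
      (hG hs) (hG ht) (by
        filter_upwards [hae] with r hr hrst z hz
        have hrG := hr (hmem hs ht hrst)
        have hd1 := hdif (w t + w s) z hz
        have hd2 := hdif (w r) z hz
        have hcoe : ⇑(w t + w s - (2 : ℝ) • w r) = ⇑(w t + w s) - (2 : ℝ) • ⇑(w r) := by
          rw [RKHS.coe_sub, RKHS.coe_smul]
        -- the bracket with `w r` does not change when a multiple of `w r` is subtracted
        have e : fderiv ℝ (w t + w s) z (w r z) - fderiv ℝ (w r) z ((w t + w s) z) =
            fderiv ℝ (w t + w s - (2 : ℝ) • w r) z (w r z) -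
              fderiv ℝ (w r) z ((w t + w s - (2 : ℝ) • w r) z) := by
          rw [hcoe, fderiv_sub hd1 (hd2.const_smul 2), fderiv_const_smul hd2]
          simp only [Pi.sub_apply, Pi.smul_apply, map_sub, map_smul, FunLike.coe_sub,
            FunLike.coe_smul]
          abel
        rw [e]
        refine (hbr _ _ z).trans ?_
        have h1 := hR r hrG
        have h2 : ‖w t + w s - (2 : ℝ) • w r‖ ≤ 2 * K * |t - s| := by
          have e2 : w t + w s - (2 : ℝ) • w r = (w t - w r) + (w s - w r) := by
            rw [two_smul]; abel
          rw [e2]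
          have h3 := (hK r hrG t ht).trans
            (mul_le_mul_of_nonneg_left (abs_sub_right_of_mem_uIcc hrst) hK0)
          have h4 := (hK r hrG s hs).trans
            (mul_le_mul_of_nonneg_left ((abs_sub_comm s r).trans_le
              (abs_sub_left_of_mem_uIcc hrst)) hK0)
          linarith [norm_add_le (w t - w r) (w s - w r)]
        gcongr)
  rw [hsum] at this
  rw [div_mul_eq_mul_div, le_div_iff₀ hκ]
  linarith

/-! ### Hilbert spaces of vector fields and momenta -/

section

variable {F : Type*} [NormedAddCommGroup F] [NormedSpace ℝ F] {U : Set F}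

/-- A function that vanishes at the boundary of `U` decays at least at the rate of its derivative
bound: integrate along the segment up to its first exit from `U`. -/
theorem norm_le_of_eq_zero_off {E : Type*} [NormedAddCommGroup E] [NormedSpace ℝ E]
    (hU : IsOpen U) {h : F → E} {C : ℝ} (h0 : ∀ x ∉ U, h x = 0)
    (hcont : Continuous h) (hd : ∀ x ∈ U, DifferentiableAt ℝ h x)
    (hC : ∀ x ∈ U, ‖fderiv ℝ h x‖ ≤ C) (hC0 : 0 ≤ C) (x : F) {y : F} (hy : y ∉ U) :
    ‖h x‖ ≤ C * ‖y - x‖ := by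
  set l : ℝ → F := fun s => x + s • (y - x) with hl
  have hlc : Continuous l := by fun_prop
  have hcpt : IsCompact (Icc (0 : ℝ) 1 ∩ l ⁻¹' Uᶜ) :=
    isCompact_Icc.inter_right (hU.isClosed_compl.preimage hlc)
  obtain ⟨t, ht, hmin⟩ := hcpt.exists_isLeast ⟨1, right_mem_Icc.mpr zero_le_one, by simp [hl, hy]⟩
  have hin : ∀ s ∈ Ico 0 t, l s ∈ U := by
    intro s hs
    by_contra hn
    exact absurd (hmin ⟨⟨hs.1, hs.2.le.trans ht.1.2⟩, hn⟩) (not_le.mpr hs.2)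
  have hld : ∀ s, HasDerivAt l (y - x) s := fun s => by
    simpa [hl] using ((hasDerivAt_id s).smul_const (y - x)).const_add x
  have key := norm_image_sub_le_of_norm_deriv_right_le_segment (f := fun s => h (l s))
    (f' := fun s => fderiv ℝ h (l s) (y - x)) (C := C * ‖y - x‖) (a := 0) (b := t)
    (hcont.comp hlc).continuousOn
    (fun s hs => ((hd _ (hin s hs)).hasFDerivAt.comp_hasDerivAt s (hld s)).hasDerivWithinAt)
    (fun s hs => (fderiv ℝ h (l s)).le_of_opNorm_le (hC _ (hin s hs)) _) t
    (right_mem_Icc.mpr ht.1.1)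
  rw [h0 _ ht.2, zero_sub, norm_neg] at key
  have hl0 : l 0 = x := by simp [hl]
  rw [hl0, sub_zero] at key
  exact key.trans (mul_le_of_le_one_right (by positivity) ht.1.2)

theorem norm_sub_le_of_eq_zero_off {E : Type*} [NormedAddCommGroup E] [NormedSpace ℝ E]
    (hU : IsOpen U) {h : F → E} {C : ℝ} (h0 : ∀ x ∉ U, h x = 0)
    (hcont : Continuous h) (hd : ∀ x ∈ U, DifferentiableAt ℝ h x)
    (hC : ∀ x ∈ U, ‖fderiv ℝ h x‖ ≤ C) (hC0 : 0 ≤ C) (x y : F) :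
    ‖h x - h y‖ ≤ C * ‖x - y‖ := by
  by_cases hseg : segment ℝ x y ⊆ U
  · exact (convex_segment x y).norm_image_sub_le_of_norm_fderiv_le (fun z hz => hd z (hseg hz))
      (fun z hz => hC z (hseg hz)) (right_mem_segment ℝ x y) (left_mem_segment ℝ x y)
  · obtain ⟨z, hz, hzU⟩ := not_subset.mp hseg
    have h1 := norm_le_of_eq_zero_off hU h0 hcont hd hC hC0 x hzU
    have h2 := norm_le_of_eq_zero_off hU h0 hcont hd hC hC0 y hzU
    have h3 := dist_add_dist_of_mem_segment hz
    rw [dist_eq_norm, dist_eq_norm, dist_eq_norm] at h3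
    rw [norm_sub_rev] at h1
    calc ‖h x - h y‖ ≤ ‖h x‖ + ‖h y‖ := norm_sub_le _ _
      _ ≤ C * (‖x - z‖ + ‖z - y‖) := by linarith
      _ = C * ‖x - y‖ := by rw [h3]

end

theorem aemeasurable_comp_of_continuousOn {F Y E : Type*} [TopologicalSpace F]
    [MeasurableSpace F] [OpensMeasurableSpace F] [MeasurableSpace Y] [TopologicalSpace E]
    [MeasurableSpace E]
    [BorelSpace E] {U : Set F} (hU : IsOpen U)
    {ν : Measure Y} {z : Y → F} {ψ : F → E} (hψ : ContinuousOn ψ U)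
    (hz : AEMeasurable z ν) (hzU : ∀ᵐ y ∂ν, z y ∈ U) : AEMeasurable (fun y => ψ (z y)) ν := by
  classical
  by_cases hY : Nonempty E
  · obtain ⟨e⟩ := hY
    have hm := hψ.measurable_piecewise (g := fun _ => e) continuousOn_const hU.measurableSet
    refine (hm.comp_aemeasurable hz).congr ?_
    filter_upwards [hzU] with y hy
    exact piecewise_eq_of_mem _ _ _ hy
  · have : IsEmpty Y := ⟨fun y => hY ⟨ψ (z y)⟩⟩
    exact (measurable_of_empty _).aemeasurable

section

variable {F : Type*} [NormedAddCommGroup F] [InnerProductSpace ℝ F] {U : Set F}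
  {H : Type*} [NormedAddCommGroup H] [InnerProductSpace ℝ H] [RKHS ℝ H F F]

variable (U H) in
/-- The elements of `H` are continuously differentiable on `U`, vanish off `U`, and are bounded and
Lipschitz with constant `c` times their norm. -/
structure IsLipschitzFieldSpace (c : ℝ) : Prop where
  nonneg : 0 ≤ c
  eq_zero : ∀ h : H, ∀ x ∉ U, h x = 0
  norm_le : ∀ (h : H) (x : F), ‖h x‖ ≤ c * ‖h‖
  norm_sub_le : ∀ (h : H) (x y : F), ‖h x - h y‖ ≤ c * ‖h‖ * ‖x - y‖
  differentiableAt : ∀ h : H, ∀ x ∈ U, DifferentiableAt ℝ h x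
  continuousOn_fderiv : ∀ h : H, ContinuousOn (fderiv ℝ h) U

namespace IsLipschitzFieldSpace

variable {c : ℝ}

theorem norm_fderiv_le (hH : IsLipschitzFieldSpace U H c) (h : H) (x : F) :
    ‖fderiv ℝ h x‖ ≤ c * ‖h‖ := by
  have := hH.nonneg
  exact norm_fderiv_le_of_lip' ℝ (by positivity)
    (Eventually.of_forall fun y => hH.norm_sub_le h y x)

theorem continuous_eval (hH : IsLipschitzFieldSpace U H c) :
    Continuous fun z : H × F => z.1 z.2 := by
  have hc := hH.nonneg
  refine continuous_iff_continuousAt.mpr fun ⟨h, x⟩ => ?_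
  rw [ContinuousAt, tendsto_iff_norm_sub_tendsto_zero]
  have hlim : Tendsto (fun z : H × F => c * ‖z.1 - h‖ + c * ‖h‖ * ‖z.2 - x‖) (𝓝 (h, x)) (𝓝 0) := by
    have : Continuous fun z : H × F => c * ‖z.1 - h‖ + c * ‖h‖ * ‖z.2 - x‖ := by fun_prop
    simpa using this.tendsto (h, x)
  refine squeeze_zero (fun _ => norm_nonneg _) (fun z => ?_) hlim
  have e : z.1 z.2 - h x = (z.1 - h) z.2 + (h z.2 - h x) := by
    rw [RKHS.coe_sub, Pi.sub_apply]; abel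
  rw [e]
  exact (norm_add_le _ _).trans (add_le_add (hH.norm_le _ _) (hH.norm_sub_le _ _ _))

theorem continuous_fderiv (hH : IsLipschitzFieldSpace U H c) :
    Continuous fun z : H × U => fderiv ℝ z.1 (z.2 : F) := by
  have hc := hH.nonneg
  refine continuous_iff_continuousAt.mpr fun ⟨h, x⟩ => ?_
  rw [ContinuousAt, tendsto_iff_norm_sub_tendsto_zero]
  have hlim : Tendsto (fun z : H × U =>
      c * ‖z.1 - h‖ + ‖fderiv ℝ h (z.2 : F) - fderiv ℝ h (x : F)‖) (𝓝 (h, x)) (𝓝 0) := by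
    have h1 : Continuous fun y : U => fderiv ℝ h (y : F) :=
      continuousOn_iff_continuous_domRestrict.mp (hH.continuousOn_fderiv h)
    have : Continuous fun z : H × U =>
        c * ‖z.1 - h‖ + ‖fderiv ℝ h (z.2 : F) - fderiv ℝ h (x : F)‖ := by
      have h2 := h1.comp (continuous_snd (X := H))
      have h3 : Continuous fun z : H × U => fderiv ℝ h (z.2 : F) := h2
      fun_prop
    simpa using this.tendsto (h, x)
  refine squeeze_zero (fun _ => norm_nonneg _) (fun z => ?_) hlim
  have e : fderiv ℝ z.1 (z.2 : F) - fderiv ℝ h (x : F) = fderiv ℝ (z.1 - h) (z.2 : F) +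
      (fderiv ℝ h (z.2 : F) - fderiv ℝ h (x : F)) := by
    rw [RKHS.coe_sub, fderiv_sub (hH.differentiableAt _ _ z.2.2) (hH.differentiableAt _ _ z.2.2)]
    abel
  rw [e]
  exact (norm_add_le _ _).trans (add_le_add (hH.norm_fderiv_le _ _) le_rfl)

end IsLipschitzFieldSpace

variable [FiniteDimensional ℝ F]

theorem IsFieldSpace.exists_isLipschitzFieldSpace [MeasurableSpace F] [BorelSpace F]
    [CompleteSpace H] {p : ℕ} (hp : 1 ≤ p) (hU : IsOpen U) (hH : IsFieldSpace p U H) :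
    ∃ c, IsLipschitzFieldSpace U H c := by
  obtain ⟨c, hc⟩ := hH.bound
  have hp' : ((1 : ℕ) : WithTop ℕ∞) ≤ p := by exact_mod_cast hp
  have hd : ∀ h : H, ∀ x ∈ U, DifferentiableAt ℝ h x := fun h x hx =>
    (((hH.contDiffOn h).differentiableOn (by
      exact_mod_cast (Nat.one_le_iff_ne_zero.mp hp))) x hx).differentiableAt (hU.mem_nhds hx)
  have hb : ∀ (h : H) i, i ≤ p → ∀ x ∈ U,
      ‖iteratedFDerivWithin ℝ i (fun x => h x) U x‖ ≤ max c 0 * ‖h‖ := fun h i hi x hx =>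
    (hc h i hi x hx).trans (mul_le_mul_of_nonneg_right (le_max_left _ _) (norm_nonneg _))
  have hfd : ∀ (h : H), ∀ x ∈ U, ‖fderiv ℝ h x‖ ≤ max c 0 * ‖h‖ := fun h x hx => by
    have := hb h 1 hp x hx
    rwa [norm_iteratedFDerivWithin_one _ (hU.uniqueDiffWithinAt hx),
      fderivWithin_of_isOpen hU hx] at this
  refine ⟨max c 0, le_max_right _ _, hH.eq_zero, fun h x => ?_, fun h x y => ?_, hd, fun h => ?_⟩
  · by_cases hx : x ∈ U
    · simpa using hb h 0 (Nat.zero_le p) x hx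
    · rw [hH.eq_zero h x hx, norm_zero]; positivity
  · exact norm_sub_le_of_eq_zero_off hU (hH.eq_zero h) (hH.continuous h) (hd h) (hfd h)
      (by positivity) x y
  · exact (hH.contDiffOn h).continuousOn_fderiv_of_isOpen hU (by exact_mod_cast hp)

namespace IsLipschitzFieldSpace

variable {c : ℝ}

/-- A square integrable path in a space of Lipschitz vector fields is a Carathéodory field. -/
theorem isCaratheodoryField (hH : IsLipschitzFieldSpace U H c) {w : ℝ → H}
    (hw : MemLp w 2 (volume.restrict (Icc (0 : ℝ) 1))) :
    IsCaratheodoryField U (fun r => ⇑(w r)) fun r => c * ‖w r‖ where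
  integrableOn := (hw.integrable one_le_two).norm.const_mul c
  norm_le r x := hH.norm_le _ _
  norm_sub_le r x y := hH.norm_sub_le _ _ _
  eq_zero r x hx := hH.eq_zero _ x hx
  differentiableAt r x hx := hH.differentiableAt _ x hx
  aestronglyMeasurable γ hγ := hH.continuous_eval.comp_aestronglyMeasurable
    (hw.aestronglyMeasurable.prodMk (hγ.aestronglyMeasurable measurableSet_Icc))
  aestronglyMeasurable_fderiv γ hγ hγU := by
    have hγ' : Continuous fun r : ℝ => (⟨γ (projIcc 0 1 zero_le_one r),
        hγU (projIcc 0 1 zero_le_one r).2⟩ : U) :=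
      Continuous.subtype_mk
        ((continuousOn_iff_continuous_domRestrict.mp hγ).comp continuous_projIcc) _
    have : SecondCountableTopology F := secondCountable_of_proper
    refine (hH.continuous_fderiv.comp_aestronglyMeasurable
      (hw.aestronglyMeasurable.prodMk hγ'.aestronglyMeasurable)).congr ?_
    refine (ae_restrict_iff' measurableSet_Icc).mpr (Eventually.of_forall fun r hr => ?_)
    simp only [projIcc_of_mem zero_le_one hr]

theorem isFlowOf (hH : IsLipschitzFieldSpace U H c) {w : ℝ → H}
    (hw : MemLp w 2 (volume.restrict (Icc (0 : ℝ) 1))) {φ : ℝ → ℝ → F → F} (hφ : IsFlow U w φ) :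
    IsFlowOf U (fun r => ⇑(w r)) φ := by
  have hX := hH.isCaratheodoryField hw
  intro s hs x hx
  obtain ⟨h1, h2⟩ := hφ s hs x hx
  refine ⟨IsPrimitive.of_eq_add (c := s) (by rwa [uIcc_zero_one]) ?_ x
    fun t ht => h2 t (by rwa [uIcc_zero_one] at ht), by simpa using h2 s hs⟩
  rw [intervalIntegrable_iff_integrableOn_Icc_of_le zero_le_one]
  exact Integrable.mono' hX.integrableOn (hX.aestronglyMeasurable _ h1)
    (Eventually.of_forall fun r => hX.norm_le r _)

theorem norm_kerFun_le [CompleteSpace H] (hH : IsLipschitzFieldSpace U H c) (x : F) :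
    ‖RKHS.kerFun H x‖ ≤ c := by
  have hc := hH.nonneg
  refine ContinuousLinearMap.opNorm_le_bound _ hc fun α => ?_
  by_contra! hlt
  have h1 : ‖RKHS.kerFun H x α‖ * ‖RKHS.kerFun H x α‖ ≤ ‖α‖ * (c * ‖RKHS.kerFun H x α‖) := by
    rw [← real_inner_self_eq_norm_mul_norm, RKHS.kerFun_inner]
    exact (real_inner_le_norm _ _).trans
      (mul_le_mul_of_nonneg_left (hH.norm_le _ _) (norm_nonneg _))
  have h2 : 0 ≤ c * ‖α‖ := by positivity
  nlinarith

theorem continuous_kerFun [CompleteSpace H] (hH : IsLipschitzFieldSpace U H c) :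
    Continuous (RKHS.kerFun H : F → F →L[ℝ] H) := by
  have hc := hH.nonneg
  refine LipschitzWith.continuous (K := c.toNNReal) (LipschitzWith.of_dist_le_mul fun x y => ?_)
  rw [Real.coe_toNNReal _ hc, dist_eq_norm, dist_eq_norm]
  refine ContinuousLinearMap.opNorm_le_bound _ (by positivity) fun α => ?_
  by_contra! hlt
  set u := (RKHS.kerFun H x - RKHS.kerFun H y) α with hu
  have h1 : ‖u‖ * ‖u‖ ≤ ‖α‖ * (c * ‖u‖ * ‖x - y‖) := by
    have e : ⟪u, u⟫_ℝ = ⟪α, u x - u y⟫_ℝ := by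
      conv_lhs => lhs; rw [hu]
      rw [FunLike.coe_sub, Pi.sub_apply, inner_sub_left, RKHS.kerFun_inner, RKHS.kerFun_inner,
        inner_sub_right]
    rw [← real_inner_self_eq_norm_mul_norm, e]
    exact (real_inner_le_norm _ _).trans
      (mul_le_mul_of_nonneg_left (hH.norm_sub_le _ _ _) (norm_nonneg _))
  have h2 : 0 ≤ c * ‖x - y‖ * ‖α‖ := by positivity
  nlinarith

end IsLipschitzFieldSpace

variable (H) in
/-- The field `k_H(ψ(x), ·) [dψ]_x^{-1*} α`, dual to the momentum `α` at `x` transported by `ψ`. -/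
noncomputable def momentumField [CompleteSpace H] (ψ : F → F) (x α : F) : H :=
  RKHS.kerFun H (ψ x) (ContinuousLinearMap.adjoint (fderiv ℝ ψ x).inverse α)

theorem inner_momentumField [CompleteSpace H] (ψ : F → F) (x α : F) (h : H) :
    ⟪momentumField H ψ x α, h⟫_ℝ = ⟪α, (fderiv ℝ ψ x).inverse (h (ψ x))⟫_ℝ := by
  rw [momentumField, RKHS.kerFun_inner, ContinuousLinearMap.adjoint_inner_left]

theorem measurable_inverse [MeasurableSpace F] [BorelSpace F] :
    Measurable (ContinuousLinearMap.inverse : (F →L[ℝ] F) → F →L[ℝ] F) := by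
  have ho : IsOpen (range ((↑) : (F ≃L[ℝ] F) → F →L[ℝ] F)) := ContinuousLinearEquiv.isOpen
  have hc : ContinuousOn (ContinuousLinearMap.inverse : (F →L[ℝ] F) → F →L[ℝ] F)
      (range ((↑) : (F ≃L[ℝ] F) → F →L[ℝ] F)) := by
    rintro _ ⟨e, rfl⟩
    exact (contDiffAt_map_inverse (n := 0) e).continuousAt.continuousWithinAt
  classical
  have := hc.measurable_piecewise (g := fun _ => (0 : F →L[ℝ] F)) continuousOn_const
    ho.measurableSet
  convert this using 1
  ext1 T
  by_cases hT : T ∈ range ((↑) : (F ≃L[ℝ] F) → F →L[ℝ] F)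
  · rw [piecewise_eq_of_mem _ _ _ hT]
  · rw [piecewise_eq_of_notMem _ _ _ hT]
    exact ContinuousLinearMap.inverse_of_not_isInvertible hT

section momentum

variable [MeasurableSpace F] [BorelSpace F] {c : ℝ} {w : ℝ → H}
  {φ : ℝ → ℝ → F → F} {Y : Type*} [MeasurableSpace Y] {ν : Measure Y} {z π : Y → F}

/-- Composition with the flow preserves almost everywhere measurability, since the flow and its
inverse are differentiable and so preserve null sets. -/
theorem aemeasurable_comp_flow (hH : IsLipschitzFieldSpace U H c)
    (hU : IsOpen U) (hw : MemLp w 2 (volume.restrict (Icc (0 : ℝ) 1))) (hφ : IsFlow U w φ)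
    {f : F → ℝ} (hf : AEMeasurable f (volume.restrict U)) :
    AEMeasurable (fun y => f (φ 1 0 y)) (volume.restrict U) := by
  have hX := hH.isCaratheodoryField hw
  have hφ' := hH.isFlowOf hw hφ
  have h0 : (0 : ℝ) ∈ Icc (0 : ℝ) 1 := left_mem_Icc.mpr zero_le_one
  have h1 : (1 : ℝ) ∈ Icc (0 : ℝ) 1 := right_mem_Icc.mpr zero_le_one
  have hm : AEMeasurable (φ 1 0) (volume.restrict U) :=
    (hX.continuousOn_flow hφ' h1 h0).aemeasurable hU.measurableSet
  refine (hf.measurable_mk.comp_aemeasurable hm).congr ?_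
  have hN := hf.ae_eq_mk
  rw [Filter.EventuallyEq, ae_restrict_iff' hU.measurableSet, ae_iff] at hN
  rw [Filter.EventuallyEq, ae_restrict_iff' hU.measurableSet, ae_iff]
  have hN' := addHaar_image_eq_zero_of_differentiableOn_of_addHaar_eq_zero volume
    (f := φ 0 1) (fun x hx => ?_) hN
  · refine measure_mono_null (fun y hy => ?_) hN'
    simp only [mem_ofPred_eq, Classical.not_imp] at hy
    refine ⟨φ 1 0 y, ?_, hX.flow_inverse hφ' h1 h0 hy.1⟩
    simp only [mem_ofPred_eq, Classical.not_imp]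
    exact ⟨hX.flow_mem hφ' h1 h0 hy.1, fun h => hy.2 h.symm⟩
  · simp only [mem_ofPred_eq, Classical.not_imp] at hx
    obtain ⟨e, he, -⟩ := hX.exists_inverse_fderiv_flow hU hφ' hx.1 h1
    exact he.differentiableAt.differentiableWithinAt

variable [CompleteSpace H]

theorem IsLipschitzFieldSpace.integrable_momentumField (hH : IsLipschitzFieldSpace U H c)
    (hU : IsOpen U) (hw : MemLp w 2 (volume.restrict (Icc (0 : ℝ) 1))) (hφ : IsFlow U w φ)
    (hz : AEMeasurable z ν) (hzU : ∀ᵐ y ∂ν, z y ∈ U) (hπ : Integrable π ν) {t : ℝ}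
    (ht : t ∈ Icc (0 : ℝ) 1) : Integrable (fun y => momentumField H (φ 0 t) (z y) (π y)) ν := by
  have hX := hH.isCaratheodoryField hw
  have hφ' := hH.isFlowOf hw hφ
  have : SecondCountableTopology F := secondCountable_of_proper
  have h0 : (0 : ℝ) ∈ Icc (0 : ℝ) 1 := left_mem_Icc.mpr zero_le_one
  have h1 : AEMeasurable (fun y => φ 0 t (z y)) ν :=
    aemeasurable_comp_of_continuousOn hU (hX.continuousOn_flow hφ' h0 ht) hz hzU
  have h2 : AEMeasurable (fun y => (fderiv ℝ (φ 0 t) (z y)).inverse) ν :=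
    (measurable_inverse.comp (measurable_fderiv ℝ (φ 0 t))).comp_aemeasurable hz
  have h3 : AEStronglyMeasurable
      (fun y => ContinuousLinearMap.adjoint (fderiv ℝ (φ 0 t) (z y)).inverse (π y)) ν :=
    (ContinuousLinearMap.id ℝ (F →L[ℝ] F)).aestronglyMeasurable_comp₂
      ((ContinuousLinearMap.adjoint (𝕜 := ℝ) (E := F) (F := F)).continuous.comp_aestronglyMeasurable
        h2.aestronglyMeasurable) hπ.aestronglyMeasurable
  have h4 : AEStronglyMeasurable (fun y => RKHS.kerFun H (φ 0 t (z y))) ν :=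
    hH.continuous_kerFun.comp_aestronglyMeasurable h1.aestronglyMeasurable
  refine Integrable.mono' (hπ.norm.const_mul (c * Real.exp (∫ r in (0 : ℝ)..1, c * ‖w r‖)))
    ((ContinuousLinearMap.id ℝ (F →L[ℝ] H)).aestronglyMeasurable_comp₂ h4 h3) ?_
  filter_upwards [hzU] with y hy
  rw [mul_assoc]
  refine (ContinuousLinearMap.le_of_opNorm_le _ (hH.norm_kerFun_le _) _).trans
    (mul_le_mul_of_nonneg_left ?_ hH.nonneg)
  refine ContinuousLinearMap.le_of_opNorm_le _ ?_ _
  rw [LinearIsometryEquiv.norm_map]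
  exact hX.norm_inverse_fderiv_flow_le hU hφ' hy ht

theorem IsLipschitzFieldSpace.inner_integral_momentumField_le (hH : IsLipschitzFieldSpace U H c)
    (hU : IsOpen U) (hw : MemLp w 2 (volume.restrict (Icc (0 : ℝ) 1))) (hφ : IsFlow U w φ)
    (hz : AEMeasurable z ν) (hzU : ∀ᵐ y ∂ν, z y ∈ U) (hπ : Integrable π ν) {t : ℝ}
    (ht : t ∈ Icc (0 : ℝ) 1) (h : H) {ε : ℝ}
    (hε : ∀ x ∈ U, ‖(fderiv ℝ (φ 0 t) x).inverse (h (φ 0 t x))‖ ≤ ε) :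
    ⟪∫ y, momentumField H (φ 0 t) (z y) (π y) ∂ν, h⟫_ℝ ≤ (∫ y, ‖π y‖ ∂ν) * ε := by
  have hi := hH.integrable_momentumField hU hw hφ hz hzU hπ ht
  rw [real_inner_comm, ← integral_inner hi, ← integral_mul_const]
  refine integral_mono_ae (hi.const_inner h) (hπ.norm.mul_const ε) ?_
  filter_upwards [hzU] with y hy
  rw [real_inner_comm, inner_momentumField]
  exact (real_inner_le_norm _ _).trans (mul_le_mul_of_nonneg_left (hε _ hy) (norm_nonneg _))

theorem IsLipschitzFieldSpace.inner_integral_momentumField_sub_le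
    (hH : IsLipschitzFieldSpace U H c)
    (hU : IsOpen U) (hw : MemLp w 2 (volume.restrict (Icc (0 : ℝ) 1))) (hφ : IsFlow U w φ)
    (hz : AEMeasurable z ν) (hzU : ∀ᵐ y ∂ν, z y ∈ U) (hπ : Integrable π ν) {s t : ℝ}
    (hs : s ∈ Icc (0 : ℝ) 1) (ht : t ∈ Icc (0 : ℝ) 1) (h : H) {ε : ℝ}
    (hε : ∀ x ∈ U, ‖(fderiv ℝ (φ 0 t) x).inverse (h (φ 0 t x)) -
      (fderiv ℝ (φ 0 s) x).inverse (h (φ 0 s x))‖ ≤ ε) :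
    ⟪(∫ y, momentumField H (φ 0 t) (z y) (π y) ∂ν) -
      ∫ y, momentumField H (φ 0 s) (z y) (π y) ∂ν, h⟫_ℝ ≤ (∫ y, ‖π y‖ ∂ν) * ε := by
  have hit := hH.integrable_momentumField hU hw hφ hz hzU hπ ht
  have his := hH.integrable_momentumField hU hw hφ hz hzU hπ hs
  have e := integral_inner (𝕜 := ℝ) (hit.sub his) h
  simp only [Pi.sub_apply] at e
  rw [← integral_sub hit his, real_inner_comm, ← e, ← integral_mul_const]
  refine integral_mono_ae ((hit.sub his).const_inner h) (hπ.norm.mul_const ε) ?_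
  filter_upwards [hzU] with y hy
  rw [real_inner_comm, inner_sub_left, inner_momentumField, inner_momentumField, ← inner_sub_right]
  exact (real_inner_le_norm _ _).trans (mul_le_mul_of_nonneg_left (hε _ hy) (norm_nonneg _))

end momentum

end

/-! ### The two geodesic equations -/

section

variable {n : ℕ} {M : Set (EuclideanSpace ℝ (Fin n))}

theorem norm_sq_eq_of_deformationEquation (hMo : IsOpen M)
    {V : Type*} [NormedAddCommGroup V] [InnerProductSpace ℝ V] [CompleteSpace V]
    [RKHS ℝ V (EuclideanSpace ℝ (Fin n)) (EuclideanSpace ℝ (Fin n))] {c : ℝ}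
    (hV : IsLipschitzFieldSpace M V c) {I₀ : EuclideanSpace ℝ (Fin n) → ℝ}
    {pa pb : EuclideanSpace ℝ (Fin n) → EuclideanSpace ℝ (Fin n)} (hpa : IntegrableOn pa M)
    (hpb : IntegrableOn pb (jumpSet M I₀) (Measure.euclideanHausdorffMeasure (n - 1)))
    {lam : ℝ} (hlam : 0 < lam) {v : ℝ → V} (hv : MemLp v 2 (volume.restrict (Icc (0 : ℝ) 1)))
    {φ : ℝ → ℝ → EuclideanSpace ℝ (Fin n) → EuclideanSpace ℝ (Fin n)} (hφ : IsFlow M v φ)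
    (hae : ∀ᵐ t ∂(volume.restrict (Icc (0 : ℝ) 1)), DeformationEquation M lam I₀ pa pb φ v t)
    {s t : ℝ} (hs : s ∈ Icc (0 : ℝ) 1) (hEs : DeformationEquation M lam I₀ pa pb φ v s)
    (ht : t ∈ Icc (0 : ℝ) 1) (hEt : DeformationEquation M lam I₀ pa pb φ v t) :
    ‖v s‖ ^ 2 = ‖v t‖ ^ 2 := by
  have hJ : ∀ᵐ x ∂((Measure.euclideanHausdorffMeasure (n - 1)).restrict (jumpSet M I₀)), x ∈ M :=
    ae_restrict_of_ae_restrict_of_subset (fun x hx => hx.1) (ae_restrict_mem hMo.measurableSet)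
  have hM : ∀ᵐ x ∂(volume.restrict M), x ∈ M := ae_restrict_mem hMo.measurableSet
  have hEq : ∀ t, DeformationEquation M lam I₀ pa pb φ v t → lam • v t =
      (∫ x in M, momentumField V (φ 0 t) x (pa x)) +
        ∫ x in jumpSet M I₀, momentumField V (φ 0 t) x (pb x)
          ∂(Measure.euclideanHausdorffMeasure (n - 1)) := fun t h => h
  refine norm_sq_eq_of_momentum hMo hV.nonneg hV.norm_le hV.norm_sub_le hV.differentiableAt
    (hV.isCaratheodoryField hv) (hV.isFlowOf hv hφ)
    (G := {t | t ∈ Icc (0 : ℝ) 1 ∧ DeformationEquation M lam I₀ pa pb φ v t}) (fun t ht => ht.1)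
    ?_ hlam (C := (∫ x in M, ‖pa x‖) + ∫ x in jumpSet M I₀, ‖pb x‖
      ∂(Measure.euclideanHausdorffMeasure (n - 1)))
    (add_nonneg (integral_nonneg fun _ => norm_nonneg _) (integral_nonneg fun _ => norm_nonneg _))
    (fun t ht h ε _ hε => ?_) (fun s hs t ht h ε _ hε => ?_) s ⟨hs, hEs⟩ t ⟨ht, hEt⟩
  · filter_upwards [hae, ae_restrict_mem measurableSet_Icc] with t h1 h2 using ⟨h2, h1⟩
  · rw [← real_inner_smul_left, hEq t ht.2, inner_add_left, add_mul]
    exact add_le_add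
      (hV.inner_integral_momentumField_le hMo hv hφ aemeasurable_id hM hpa ht.1 h hε)
      (hV.inner_integral_momentumField_le hMo hv hφ aemeasurable_id hJ hpb ht.1 h hε)
  · rw [← real_inner_smul_left, smul_sub, hEq t ht.2, hEq s hs.2, add_sub_add_comm,
      inner_add_left, add_mul]
    exact add_le_add
      (hV.inner_integral_momentumField_sub_le hMo hv hφ aemeasurable_id hM hpa hs.1 ht.1 h hε)
      (hV.inner_integral_momentumField_sub_le hMo hv hφ aemeasurable_id hJ hpb hs.1 ht.1 h hε)

/-- On the line, `dη_{t,1}` at `η_{0,t}(z)` is `dη_{0,1} (dη_{0,t})⁻¹` at `z`, so the integrand of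
the contrast equation is the field of a momentum at `z` transported by `η_{0,t}`. -/
theorem smul_kerFun_eq_momentumField {S : Type*} [NormedAddCommGroup S] [InnerProductSpace ℝ S]
    [CompleteSpace S] [RKHS ℝ S ℝ ℝ] {X : ℝ → ℝ → ℝ} {k : ℝ → ℝ}
    (hX : IsCaratheodoryField (univ : Set ℝ) X k) {η : ℝ → ℝ → ℝ → ℝ}
    (hη : IsFlowOf (univ : Set ℝ) X η) {t : ℝ} (ht : t ∈ Icc (0 : ℝ) 1) (z a : ℝ) :
    (a * deriv (η t 1) (η 0 t z)) • RKHS.kerFun S (η 0 t z) (1 : ℝ) =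
      momentumField S (η 0 t) z (a * deriv (η 0 1) z) := by
  have h0 : (0 : ℝ) ∈ Icc (0 : ℝ) 1 := left_mem_Icc.mpr zero_le_one
  have h1 : (1 : ℝ) ∈ Icc (0 : ℝ) 1 := right_mem_Icc.mpr zero_le_one
  obtain ⟨e, he, -⟩ := hX.exists_inverse_fderiv_flow isOpen_univ hη (mem_univ z) ht
  obtain ⟨e₁, he₁, -⟩ := hX.exists_inverse_fderiv_flow isOpen_univ hη (mem_univ z) h1
  have hback : η t 0 (η 0 t z) = z := hX.flow_inverse hη h0 ht (mem_univ z)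
  have hinv : HasFDerivAt (η t 0) (e.symm : ℝ →L[ℝ] ℝ) (η 0 t z) := by
    refine HasFDerivAt.of_local_left_inverse (f := η 0 t) ?_ (by rwa [hback])
      (Eventually.of_forall fun y => hX.flow_inverse hη ht h0 (mem_univ y))
    exact (hX.continuousOn_flow hη ht h0).continuousAt univ_mem
  have hcomp : η t 1 = η 0 1 ∘ η t 0 :=
    funext fun y => (hX.flow_comp hη ht h0 h1 (mem_univ y)).symm
  have hd : deriv (η t 1) (η 0 t z) = e₁ (e.symm 1) := by
    rw [hcomp, ← fderiv_apply_one_eq_deriv,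
      (HasFDerivAt.comp (η 0 t z) (g := η 0 1) (by rwa [hback]) hinv).fderiv]
    rfl
  have hd₁ : deriv (η 0 1) z = e₁ 1 := by
    rw [← fderiv_apply_one_eq_deriv, he₁.fderiv]; rfl
  have hmul : e₁ (e.symm 1) = e.symm 1 * e₁ 1 := by
    have := e₁.map_smul (e.symm 1) 1
    simpa using this
  have hadj : ContinuousLinearMap.adjoint (e.symm : ℝ →L[ℝ] ℝ) (a * e₁ 1) =
      (a * e₁ (e.symm 1)) • (1 : ℝ) := by
    have h := ContinuousLinearMap.adjoint_inner_left (e.symm : ℝ →L[ℝ] ℝ) 1 (a * e₁ 1)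
    simp only [RCLike.inner_apply, conj_trivial, ContinuousLinearEquiv.coe_coe] at h
    rw [hmul]
    simp only [smul_eq_mul]
    linarith
  rw [momentumField, he.fderiv, ContinuousLinearMap.inverse_equiv, hd, hd₁, hadj, map_smul]

theorem norm_sq_eq_of_contrastEquation (hMo : IsOpen M)
    {V : Type*} [NormedAddCommGroup V] [InnerProductSpace ℝ V]
    [RKHS ℝ V (EuclideanSpace ℝ (Fin n)) (EuclideanSpace ℝ (Fin n))] {c : ℝ}
    (hV : IsLipschitzFieldSpace M V c)
    {S : Type*} [NormedAddCommGroup S] [InnerProductSpace ℝ S] [CompleteSpace S]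
    [RKHS ℝ S ℝ ℝ] {d : ℝ} (hS : IsLipschitzFieldSpace (univ : Set ℝ) S d)
    {I₀ : EuclideanSpace ℝ (Fin n) → ℝ} (hI₀ : AEMeasurable I₀ (volume.restrict M))
    {pc : EuclideanSpace ℝ (Fin n) → ℝ} (hpc : IntegrableOn pc M) {β : ℝ} (hβ : 0 < β)
    {v : ℝ → V} (hv : MemLp v 2 (volume.restrict (Icc (0 : ℝ) 1)))
    {u : ℝ → S} (hu : MemLp u 2 (volume.restrict (Icc (0 : ℝ) 1)))
    {φ : ℝ → ℝ → EuclideanSpace ℝ (Fin n) → EuclideanSpace ℝ (Fin n)} (hφ : IsFlow M v φ)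
    {η : ℝ → ℝ → ℝ → ℝ} (hη : IsFlow (univ : Set ℝ) u η)
    (hae : ∀ᵐ t ∂(volume.restrict (Icc (0 : ℝ) 1)), ContrastEquation M β I₀ pc φ η u t)
    {s t : ℝ} (hs : s ∈ Icc (0 : ℝ) 1) (hEs : ContrastEquation M β I₀ pc φ η u s)
    (ht : t ∈ Icc (0 : ℝ) 1) (hEt : ContrastEquation M β I₀ pc φ η u t) :
    ‖u s‖ ^ 2 = ‖u t‖ ^ 2 := by
  have hX := hS.isCaratheodoryField hu
  have hη' := hS.isFlowOf hu hη
  have h1 : (1 : ℝ) ∈ Icc (0 : ℝ) 1 := right_mem_Icc.mpr zero_le_one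
  set z : EuclideanSpace ℝ (Fin n) → ℝ := fun y => I₀ (φ 1 0 y) with hz
  set π : EuclideanSpace ℝ (Fin n) → ℝ := fun y => pc y * deriv (η 0 1) (z y) with hπ
  have hzm : AEMeasurable z (volume.restrict M) := aemeasurable_comp_flow hV hMo hv hφ hI₀
  have hzU : ∀ᵐ y ∂(volume.restrict M), z y ∈ (univ : Set ℝ) :=
    Eventually.of_forall fun _ => trivial
  have hπi : IntegrableOn π M := by
    refine Integrable.mul_bdd (c := Real.exp (∫ r in (0 : ℝ)..1, d * ‖u r‖)) hpc
      ((measurable_deriv (η 0 1)).comp_aemeasurable hzm).aestronglyMeasurable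
      (Eventually.of_forall fun y => ?_)
    obtain ⟨e, he, hle, -⟩ := hX.exists_inverse_fderiv_flow isOpen_univ hη' (mem_univ (z y)) h1
    rwa [norm_deriv_eq_norm_fderiv, he.fderiv]
  have hEq : ∀ t ∈ Icc (0 : ℝ) 1, ContrastEquation M β I₀ pc φ η u t →
      β • u t = ∫ y in M, momentumField S (η 0 t) (z y) (π y) := by
    intro t ht h
    refine Eq.trans h (integral_congr_ae (Eventually.of_forall fun y => ?_))
    exact smul_kerFun_eq_momentumField hX hη' ht (z y) (pc y)
  refine norm_sq_eq_of_momentum isOpen_univ hS.nonneg hS.norm_le hS.norm_sub_le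
    hS.differentiableAt hX hη'
    (G := {t | t ∈ Icc (0 : ℝ) 1 ∧ ContrastEquation M β I₀ pc φ η u t}) (fun t ht => ht.1)
    ?_ hβ (C := ∫ y in M, ‖π y‖) (integral_nonneg fun _ => norm_nonneg _)
    (fun t ht h ε _ hε => ?_) (fun s hs t ht h ε _ hε => ?_) s ⟨hs, hEs⟩ t ⟨ht, hEt⟩
  · filter_upwards [hae, ae_restrict_mem measurableSet_Icc] with t h1 h2 using ⟨h2, h1⟩
  · rw [← real_inner_smul_left, hEq t ht.1 ht.2]
    exact hS.inner_integral_momentumField_le isOpen_univ hu hη hzm hzU hπi ht.1 h hε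
  · rw [← real_inner_smul_left, smul_sub, hEq t ht.1 ht.2, hEq s hs.1 hs.2]
    exact hS.inner_integral_momentumField_sub_le isOpen_univ hu hη hzm hzU hπi hs.1 ht.1 h hε

end

end ImageMatching

theorem mainTheorem5 {n p q : ℕ} (hn : 1 ≤ n) (hp : 1 ≤ p) (hq : 1 ≤ q)
    (M : Set (EuclideanSpace ℝ (Fin n))) (hMo : IsOpen M) (hMb : Bornology.IsBounded M)
    {V : Type*} [NormedAddCommGroup V] [InnerProductSpace ℝ V] [CompleteSpace V]
    [RKHS ℝ V (EuclideanSpace ℝ (Fin n)) (EuclideanSpace ℝ (Fin n))]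
    (hV : ImageMatching.IsFieldSpace p M V)
    {S : Type*} [NormedAddCommGroup S] [InnerProductSpace ℝ S] [CompleteSpace S]
    [RKHS ℝ S ℝ ℝ]
    (hS : ImageMatching.IsFieldSpace q (Set.univ : Set ℝ) S)
    (I₀ : EuclideanSpace ℝ (Fin n) → ℝ) (hI₀ : ImageMatching.IsImage M I₀)
    (pa pb : EuclideanSpace ℝ (Fin n) → EuclideanSpace ℝ (Fin n))
    (pc : EuclideanSpace ℝ (Fin n) → ℝ)
    (hpa : IntegrableOn pa M)
    (hpb : IntegrableOn pb (ImageMatching.jumpSet M I₀)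
      (Measure.euclideanHausdorffMeasure (n - 1)))
    (hpc : IntegrableOn pc M)
    (lam β : ℝ) (hlam : 0 < lam) (hβ : 0 < β)
    (v : ℝ → V) (hv : MemLp v 2 (volume.restrict (Icc (0 : ℝ) 1)))
    (s : ℝ → S) (hs : MemLp s 2 (volume.restrict (Icc (0 : ℝ) 1)))
    (φ : ℝ → ℝ → EuclideanSpace ℝ (Fin n) → EuclideanSpace ℝ (Fin n))
    (hφ : ImageMatching.IsFlow M v φ)
    (η : ℝ → ℝ → ℝ → ℝ) (hη : ImageMatching.IsFlow (Set.univ : Set ℝ) s η) :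
    (ImageMatching.HasDifferentiableKernel (Set.univ : Set ℝ) S →
      (∀ᵐ t ∂(volume.restrict (Icc (0 : ℝ) 1)),
        ImageMatching.ContrastEquation M β I₀ pc φ η s t) →
      ∃ c : ℝ, ∀ t ∈ Icc (0 : ℝ) 1,
        ImageMatching.ContrastEquation M β I₀ pc φ η s t → ‖s t‖ ^ 2 = c) ∧
    (ImageMatching.HasDifferentiableKernel M V →
      (∀ᵐ t ∂(volume.restrict (Icc (0 : ℝ) 1)),
        ImageMatching.DeformationEquation M lam I₀ pa pb φ v t) →
      ∃ c : ℝ, ∀ t ∈ Icc (0 : ℝ) 1,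
        ImageMatching.DeformationEquation M lam I₀ pa pb φ v t → ‖v t‖ ^ 2 = c) := by
  obtain ⟨c, hc⟩ := hV.exists_isLipschitzFieldSpace hp hMo
  obtain ⟨d, hd⟩ := hS.exists_isLipschitzFieldSpace hq isOpen_univ
  -- a property of pairs of times makes the value constant also when no time qualifies
  have hconst : ∀ (f : ℝ → ℝ) (E : ℝ → Prop),
      (∀ s ∈ Icc (0 : ℝ) 1, E s → ∀ t ∈ Icc (0 : ℝ) 1, E t → f s = f t) →
      ∃ c : ℝ, ∀ t ∈ Icc (0 : ℝ) 1, E t → f t = c := by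
    intro f E h
    by_cases hE : ∃ s ∈ Icc (0 : ℝ) 1, E s
    · obtain ⟨s, hs, hEs⟩ := hE
      exact ⟨f s, fun t ht hEt => h t ht hEt s hs hEs⟩
    · exact ⟨0, fun t ht hEt => absurd ⟨t, ht, hEt⟩ hE⟩
  refine ⟨fun _ hae => hconst _ _ fun r hr hEr t ht hEt => ?_,
    fun _ hae => hconst _ _ fun r hr hEr t ht hEt => ?_⟩
  · exact ImageMatching.norm_sq_eq_of_contrastEquation hMo hc hd
      hI₀.1.1.aestronglyMeasurable.aemeasurable hpc hβ hv hs hφ hη hae hr hEr ht hEt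
  · exact ImageMatching.norm_sq_eq_of_deformationEquation hMo hc hpa hpb hlam hv hφ hae
      hr hEr ht hEt
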